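/- Let $n\ge 0$ and $0\le m\le n/2$ be integers. The symmetric group $S_n$ permutes the coordinates of the binary words $C_2^n=\{0,1\}^n$ and hence acts on the space $L(C_2^n)$ of functions $C_2^n\to\mathbb{C}$; identifying $L(C_2^n)$ with $(\mathbb{C}^2)^{\otimes n}$, the Lie algebra $\mathfrak{sl}_2(\mathbb{C})$ acts on it too. Let $K_n$ be the binary Burnside operator $K_nf(x)=\sum_{y}K_n(x,y)f(y)$, where $$K_n(x,y)=\frac{1}{|G_x|}\sum_{s\in G_x\cap G_y}\frac{1}{|\mathfrak{X}_s|},$$ $G_x\subseteq S_n$ is the stabilizer of $x$ and $\mathfrak{X}_s\subseteq C_2^n$ is the set of words fixed by $s$. Put $\beta_k=\frac{1}{2^{4k}}\binom{2k}{k}^2$. Let $\lambda=(n-m,m)$, let $S^\lambda$ be the Specht module of $S_n$, and let $W^\lambda\subseteq L(C_2^n)$ be the $S_n$-isotypic component of type $S^\lambda$. Then there is an irreducible $\mathfrak{sl}_2(\mathbb{C})$-module $L^\lambda$ with an isomorphism $S^\lambda\otimes L^\lambda\cong W^\lambda$ commuting with both $S_n$ (acting on $S^\lambda$) and $\mathfrak{sl}_2(\mathbb{C})$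 (acting on $L^\lambda$). The operator $K_n$ maps $W^\lambda$ to itself; let $K_n^\lambda$ be its restriction. For every complex vector space $L$ and every $S_n$-equivariant isomorphism $S^\lambda\otimes L\cong W^\lambda$ (with $S_n$ acting on $S^\lambda$ only), in particular for $L=L^\lambda$, there is exactly one linear operator $\tilde K_n^\lambda$ on $L$ such that $K_n^\lambda$ corresponds to $I_{S^\lambda}\otimes\tilde K_n^\lambda$, and the following hold. 1. For every integer $k$ with $0\le k\le n/2$ and $m\le\min(2k,n-2k)$, $\beta_k$ is an eigenvalue of $\tilde K_n^\lambda$ of multiplicity $1$, and an eigenvalue of $K_n^\lambda$ of multiplicity $\dim S^\lambda$ (geometric and algebraic multiplicity alike). 2. The nonzero eigenvalues of $\tilde K_n^\lambda$, and likewise those of $K_n^\lambda$, are exactly the numbers $\beta_k$ for these $k$. -/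

import Mathlib

open scoped TensorProduct

noncomputable section

/-! ### Permutation representations on spaces of functions -/

/-- The permutation representation of `G` on the complex functions on a `G`-set `X`:
`(g f)(x) = f (g⁻¹ x)`; it sends the indicator of `x` to the indicator of `g x`. -/
def functionRep (G X : Type*) [Group G] [MulAction G X] : Representation ℂ G (X → ℂ) where
  toFun g :=
    { toFun := fun f x => f (g⁻¹ • x)
      map_add' := fun _ _ => rfl
      map_smul' := fun _ _ => rfl }
  map_one' := by ext f x; simp
  map_mul' g h := by ext f x; simp [mul_smul]

theorem functionRep_single {G X : Type*} [Group G] [MulAction G X] [DecidableEq X] (g : G)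
    (x : X) (c : ℂ) : functionRep G X g (Pi.single x c) = Pi.single (g • x) c := by
  funext y
  simp [functionRep, Pi.single_apply, inv_smul_eq_iff]

/-- The isotypic component of type `σ` in `ρ`, as a complex subspace of the space of `ρ`: the sum
of all subrepresentations of `ρ` that are isomorphic to `σ`. -/
def isotypicPart {G V W : Type*} [Group G] [AddCommGroup V] [Module ℂ V] [AddCommGroup W]
    [Module ℂ W] (ρ : Representation ℂ G V) (σ : Representation ℂ G W) : Submodule ℂ V :=
  ((isotypicComponent (MonoidAlgebra ℂ G) ρ.asModule σ.asModule).restrictScalars ℂ).map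
    ρ.asModuleEquiv.toLinearMap

/-- Words of length `n` over the alphabet `A`. -/
abbrev Word (n : ℕ) (A : Type*) := Fin n → A

/-- The symmetric group permutes the coordinates of words: `(s x) (s i) = x i`. -/
instance wordAction (n : ℕ) (A : Type*) : MulAction (Equiv.Perm (Fin n)) (Word n A) where
  smul s x := fun i => x (s⁻¹ i)
  one_smul _ := rfl
  mul_smul _ _ _ := rfl

/-! ### The Burnside process -/

open Classical in
/-- The transition probabilities of the Burnside process of a finite group `G` acting on a finite
set `X`: `K(x, y) = 1/|G_x| * ∑_{s ∈ G_x ∩ G_y} 1/|X_s|`, where `X_s` is the fixed-point set. -/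
def burnsideKernel (G X : Type*) [Group G] [Fintype G] [MulAction G X] (x y : X) : ℝ :=
  1 / (Nat.card (MulAction.stabilizer G x) : ℝ) *
    ∑ s : G with s ∈ MulAction.stabilizer G x ∧ s ∈ MulAction.stabilizer G y,
      1 / (Nat.card (MulAction.fixedBy X s) : ℝ)

/-- The Burnside operator on functions, `(K f)(x) = ∑_y K(x, y) f(y)`. -/
def burnsideOperator (G X : Type*) [Group G] [Fintype G] [Fintype X] [MulAction G X] :
    Module.End ℂ (X → ℂ) where
  toFun f x := ∑ y, (burnsideKernel G X x y : ℂ) * f y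
  map_add' f g := by funext x; simp [mul_add, Finset.sum_add_distrib]
  map_smul' c f := by funext x; simp [Finset.mul_sum, mul_left_comm]

/-- The space `L(C₂ⁿ)` of complex functions on the binary words of length `n`. -/
abbrev BinaryFun (n : ℕ) := Word n (Fin 2) → ℂ

/-- The action of the symmetric group on `L(C₂ⁿ)` by permuting coordinates. -/
abbrev binaryRep (n : ℕ) : Representation ℂ (Equiv.Perm (Fin n)) (BinaryFun n) :=
  functionRep (Equiv.Perm (Fin n)) (Word n (Fin 2))

/-- The binary Burnside operator `K_n`. -/
abbrev binaryBurnside (n : ℕ) : Module.End ℂ (BinaryFun n) :=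
  burnsideOperator (Equiv.Perm (Fin n)) (Word n (Fin 2))

/-- The numbers `β_k = binom(2k, k)² / 2^(4k)`. -/
def burnsideEigenvalue (k : ℕ) : ℂ := ((2 * k).choose k : ℂ) ^ 2 / 2 ^ (4 * k)

/-! ### Specht modules -/

/-- A (bijective) Young tableau of shape `μ` with entries in `Fin n`: the map sending each entry
to the cell (row, column) that contains it. -/
abbrev Tableau (n : ℕ) (μ : YoungDiagram) := Fin n ≃ μ.cells

/-- The tabloid of a tableau, recorded as the word that lists the row of each entry. Two tableaux
have the same tabloid exactly when they are row equivalent. -/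
def Tableau.tabloid {n : ℕ} {μ : YoungDiagram} (T : Tableau n μ) : Word n ℕ :=
  fun i => (T i).1.1

/-- The polytabloid `e_T = ∑ sgn(s) s{T}`, where `s` runs over the permutations that preserve
every column of `T`, in the space of functions on words (spanned here by indicators). -/
def Tableau.polytabloid {n : ℕ} {μ : YoungDiagram} (T : Tableau n μ) : Word n ℕ → ℂ :=
  ∑ s : Equiv.Perm (Fin n) with ∀ i, (T (s i)).1.2 = (T i).1.2,
    Pi.single (s • T.tabloid) ((Equiv.Perm.sign s : ℤ) : ℂ)

theorem Tableau.functionRep_polytabloid {n : ℕ} {μ : YoungDiagram} (T : Tableau n μ)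
    (g : Equiv.Perm (Fin n)) :
    functionRep (Equiv.Perm (Fin n)) (Word n ℕ) g T.polytabloid =
      Tableau.polytabloid (g⁻¹.trans T : Tableau n μ) := by
  unfold Tableau.polytabloid
  rw [map_sum]
  refine Finset.sum_bij' (fun s _ => g * s * g⁻¹) (fun s _ => g⁻¹ * s * g) ?_ ?_ ?_ ?_ ?_
  · intro s hs
    simp only [Finset.mem_filter, Finset.mem_univ, true_and] at hs ⊢
    intro i
    simpa using hs (g⁻¹ i)
  · intro s hs
    simp only [Finset.mem_filter, Finset.mem_univ, true_and] at hs ⊢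
    intro i
    simpa using hs (g i)
  · intro s _; group
  · intro s _; group
  · intro s _
    rw [functionRep_single]
    have h1 : Tableau.tabloid (g⁻¹.trans T : Tableau n μ) = g • T.tabloid := rfl
    rw [h1, smul_smul, smul_smul, inv_mul_cancel_right]
    have h2 : Equiv.Perm.sign (g * s * g⁻¹) = Equiv.Perm.sign s := by
      rw [map_mul, map_mul, Equiv.Perm.sign_inv, mul_right_comm, Int.units_mul_self, one_mul]
    rw [h2]

/-- The Specht module `S^μ` of the symmetric group on `Fin n`: the span of the polytabloids of all
tableaux of shape `μ`, as a subrepresentation of the permutation module on tabloids. -/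
def spechtSub (n : ℕ) (μ : YoungDiagram) :
    Subrepresentation (functionRep (Equiv.Perm (Fin n)) (Word n ℕ)) where
  toSubmodule := Submodule.span ℂ (Set.range (Tableau.polytabloid (n := n) (μ := μ)))
  apply_mem_toSubmodule g v hv := by
    have h : Submodule.span ℂ (Set.range (Tableau.polytabloid (n := n) (μ := μ))) ≤
        (Submodule.span ℂ (Set.range (Tableau.polytabloid (n := n) (μ := μ)))).comap
          (functionRep (Equiv.Perm (Fin n)) (Word n ℕ) g) := by
      rw [Submodule.span_le]
      rintro _ ⟨T, rfl⟩
      simp only [Submodule.comap_coe, Set.mem_preimage, SetLike.mem_coe]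
      rw [T.functionRep_polytabloid]
      exact Submodule.subset_span ⟨_, rfl⟩
    exact h hv

/-- The underlying vector space of the Specht module. -/
abbrev Specht (n : ℕ) (μ : YoungDiagram) := (spechtSub n μ).toSubmodule

/-- The action of the symmetric group on the Specht module. -/
abbrev spechtRep (n : ℕ) (μ : YoungDiagram) :
    Representation ℂ (Equiv.Perm (Fin n)) (Specht n μ) :=
  (spechtSub n μ).toRepresentation

/-- The Young diagram of the partition `(n - m, m)` of `n`. -/
def twoRow (n m : ℕ) (hm : 2 * m ≤ n) : YoungDiagram :=
  YoungDiagram.ofRowLens [n - m, m] (by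
    apply List.Pairwise.sortedGE
    simp
    omega)

/-- The component of type `S^λ` of `L(C₂ⁿ)` for the action of the symmetric group. -/
abbrev spechtIsotypic (n : ℕ) (μ : YoungDiagram) : Submodule ℂ (BinaryFun n) :=
  isotypicPart (binaryRep n) (spechtRep n μ)

/-! ### The action of `sl₂` -/

/-- The Lie algebra `sl₂(ℂ)`. -/
abbrev sl2 := LieAlgebra.SpecialLinear.sl (Fin 2) ℂ

/-- The action of a matrix `A` in `sl₂` on `L(C₂ⁿ) = (ℂ²)^{⊗ n}`, `∑_i 1 ⊗ ⋯ ⊗ A ⊗ ⋯ ⊗ 1` with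
`A` in position `i`, where the word `x` stands for `v_{x 1} ⊗ ⋯ ⊗ v_{x n}` and
`A v_b = ∑_a A a b • v_a`. -/
def sl2Action (n : ℕ) (A : sl2) : Module.End ℂ (BinaryFun n) where
  toFun f x := ∑ i, ∑ b, A.1 (x i) b * f (Function.update x i b)
  map_add' f g := by funext x; simp [mul_add, Finset.sum_add_distrib]
  map_smul' c f := by
    funext x
    simp only [Pi.smul_apply, smul_eq_mul, RingHom.id_apply, Finset.mul_sum]
    simp only [mul_left_comm]

/-! ### Identifications of the isotypic component with a tensor product -/

/-- `Φ : S^λ ⊗ L → (isotypic component)` commutes with the symmetric group, which acts on the left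
tensor factor. -/
def IsPermEquivariant {n : ℕ} {μ : YoungDiagram} {L : Type*} [AddCommGroup L] [Module ℂ L]
    (Φ : Specht n μ ⊗[ℂ] L ≃ₗ[ℂ] spechtIsotypic n μ) : Prop :=
  ∀ (g : Equiv.Perm (Fin n)) (s : Specht n μ) (l : L),
    (Φ (spechtRep n μ g s ⊗ₜ[ℂ] l) : BinaryFun n) = binaryRep n g (Φ (s ⊗ₜ[ℂ] l))

/-- `Φ : S^λ ⊗ L → (isotypic component)` commutes with `sl₂`, which acts on the right tensor
factor. -/
def IsSl2Equivariant {n : ℕ} {μ : YoungDiagram} {L : Type*} [AddCommGroup L] [Module ℂ L]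
    [LieRingModule sl2 L] (Φ : Specht n μ ⊗[ℂ] L ≃ₗ[ℂ] spechtIsotypic n μ) : Prop :=
  ∀ (A : sl2) (s : Specht n μ) (l : L),
    (Φ (s ⊗ₜ[ℂ] ⁅A, l⁆) : BinaryFun n) = sl2Action n A (Φ (s ⊗ₜ[ℂ] l))

/-- `c` is an eigenvalue of `T` with geometric and algebraic multiplicity both equal to `d`
(`d = 0` means that `c` is not an eigenvalue, for finite-dimensional spaces). -/
def HasMultiplicity {V : Type*} [AddCommGroup V] [Module ℂ V] (T : Module.End ℂ V) (c : ℂ)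
    (d : ℕ) : Prop :=
  Module.finrank ℂ (T.eigenspace c) = d ∧ Module.finrank ℂ (T.maxGenEigenspace c) = d

end

/-! A permutation `s` fixes 2^(number of cycles) binary words. Building permutations by inserting
one point at a time turns the sum of 1/2^(cycles) over the permutations preserving a colouring into
a product of rising factorials (1/2)(3/2)⋯ of the colour counts (`sum_inv_fixedWords`). Colouring
position `i` by `(x i, y i)` makes `K_n(x, y)` a product of two arcsine moments. Hence `K_n =
E[M^{⊗n}]`, where `M` has rows `(θ, 1-θ)` and `(φ, 1-φ)`, and θ, φ are independent arcsine variables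
(`burnsideMatrix_apply`).

In the constant basis `(1,1), (1,-1)` the matrix `M` becomes upper triangular with diagonal `1,
θ-φ`. So `K_n` is conjugate, compatibly with `S_n`, to an operator that is block triangular for the
weight of words and acts on the diagonal block of weight `l` as the scalar `E[(θ-φ)^l]`. Integration
by parts gives a two-step recursion for these moments: they vanish for odd `l` and equal β_k for `l
= 2k` (`differenceMoment_odd`, `differenceMoment_even`).

The multiplicity space is `Hom_{S_n}(S^λ, L(C₂ⁿ))`. An intertwining map is determined by the image
of one polytabloid, which is supported on words separating the `m` columns of height two; this
leaves at most one dimension for each weight from `m` to `n-m`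
(`Tableau.intertwiningMap_apply_ne_zero`). Restriction of functions to binary words is a highest
weight vector, and its images under the lowering operator fill all these weights (`span_lowered`).
This gives irreducibility under `sl₂` and an evaluation isomorphism `S^λ ⊗ Hom ≅ W^λ` without using
the irreducibility of Specht modules.

The characteristic polynomial on the multiplicity space is therefore the product of `X - E[(θ-φ)^l]`
over `m ≤ l ≤ n-m` (`charpoly_multiplicityBurnside`). The β_k are distinct and nonzero, so each one
that occurs is a simple root. Tensoring with `S^λ` multiplies multiplicities by its dimension, and
`toMultiplicitySpace_bijective` reduces every other identification to evaluation. -/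

/-! ### The Burnside kernel as a product of rising factorials. -/

open Finset in
/-- A permutation of `Fin (n + 1)`, built by inserting `0` before `p` in a permutation `e`,
preserves `z` exactly when `e` preserves the tail of `z` and `p` has the same value as `0`. -/
theorem comp_decomposeFin_symm_eq_iff {n : ℕ} {C : Type*} (z : Fin (n + 1) → C) (p : Fin (n + 1))
    (e : Equiv.Perm (Fin n)) :
    (∀ i, z (Equiv.Perm.decomposeFin.symm (p, e) i) = z i) ↔
      z p = z 0 ∧ ∀ i, z (e i).succ = z i.succ := by
  have key : z p = z 0 → ∀ j, z (Equiv.swap 0 p j) = z j := by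
    intro h j
    rcases eq_or_ne j 0 with rfl | h0
    · simpa using h
    rcases eq_or_ne j p with rfl | h1
    · simpa using h.symm
    rw [Equiv.swap_apply_of_ne_of_ne h0 h1]
  constructor
  · intro h
    have h0 : z p = z 0 := by simpa using h 0
    refine ⟨h0, fun i => ?_⟩
    have := h i.succ
    rwa [Equiv.Perm.decomposeFin_symm_apply_succ, key h0] at this
  · rintro ⟨h0, h⟩ i
    refine Fin.cases (by simpa using h0) (fun i => ?_) i
    rw [Equiv.Perm.decomposeFin_symm_apply_succ, key h0, h]

/-- The rising factorial `(1/2)(3/2)⋯(n - 1/2)`. -/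
noncomputable def halfRising (n : ℕ) : ℂ := ∏ j ∈ Finset.range n, (1 / 2 + (j : ℂ))

theorem halfRising_zero : halfRising 0 = 1 := rfl

theorem halfRising_succ (n : ℕ) : halfRising (n + 1) = halfRising n * (1 / 2 + n) :=
  Finset.prod_range_succ _ _

/-- The number of binary words fixed by a permutation. -/
noncomputable def fixedWords {n : ℕ} (s : Equiv.Perm (Fin n)) : ℕ :=
  Nat.card {w : Fin n → Fin 2 // ∀ i, w (s i) = w i}

/-- For `p = 0` the new point is a cycle of its own and its letter is free; otherwise it joins the
cycle of `p`, which dictates its letter. -/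
theorem fixedWords_decomposeFin {n : ℕ} (p : Fin (n + 1)) (e : Equiv.Perm (Fin n)) :
    fixedWords (Equiv.Perm.decomposeFin.symm (p, e)) =
      if p = 0 then 2 * fixedWords e else fixedWords e := by
  unfold fixedWords
  simp only [comp_decomposeFin_symm_eq_iff]
  refine Fin.cases ?_ (fun q => ?_) p
  · rw [if_pos rfl]
    have h2 (A : Type) : 2 * Nat.card A = Nat.card (Fin 2 × A) := by
      rw [Nat.card_prod, Nat.card_fin]
    rw [h2]
    refine Nat.card_congr
      { toFun := fun w => (w.1 0, ⟨fun i => w.1 i.succ, w.2.2⟩)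
        invFun := fun v => ⟨Fin.cons v.1 v.2.1, by simpa using v.2.2⟩
        left_inv := fun w => by
          ext i : 2
          refine Fin.cases ?_ (fun i => ?_) i <;> simp
        right_inv := fun v => by ext <;> simp }
  · rw [if_neg (Fin.succ_ne_zero q)]
    refine Nat.card_congr
      { toFun := fun w => ⟨fun i => w.1 i.succ, w.2.2⟩
        invFun := fun v => ⟨Fin.cons (v.1 q) v.1, by simpa using v.2⟩
        left_inv := fun w => by
          ext i : 2
          refine Fin.cases ?_ (fun i => ?_) i
          · simpa using w.2.1
          · simp
        right_inv := fun v => by ext; simp }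

-- Induction on `n` by inserting the point `0`. As a new cycle it contributes 1/2; in front of a
-- point `p` of its own colour it contributes 1. The total is 1/2 plus the number of other points of
-- that colour, the next factor of the rising factorial.
open Finset in
theorem sum_inv_fixedWords {C : Type*} [Fintype C] [DecidableEq C] (n : ℕ) (z : Fin n → C) :
    ∑ s : Equiv.Perm (Fin n) with ∀ i, z (s i) = z i, (1 / (fixedWords s : ℂ)) =
      ∏ c, halfRising #{i | z i = c} := by
  induction n with
  | zero =>
    have h : fixedWords (1 : Equiv.Perm (Fin 0)) = 1 := by
      unfold fixedWords
      rw [Nat.card_eq_one_iff_unique]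
      exact ⟨inferInstance, ⟨⟨Fin.elim0, fun i => i.elim0⟩⟩⟩
    rw [Finset.sum_filter, Fintype.sum_unique]
    have h1 : (default : Equiv.Perm (Fin 0)) = 1 := Subsingleton.elim _ _
    simp [h1, h, halfRising_zero]
  | succ n ih =>
    rw [Finset.sum_filter, ← Equiv.Perm.decomposeFin.symm.sum_comp, Fintype.sum_prod_type]
    simp only [comp_decomposeFin_symm_eq_iff, fixedWords_decomposeFin]
    have h1 : ∀ p : Fin (n + 1), (∑ e : Equiv.Perm (Fin n),
        if z p = z 0 ∧ ∀ i, z (e i).succ = z i.succ then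
          1 / ((if p = 0 then 2 * fixedWords e else fixedWords e : ℕ) : ℂ) else 0) =
        if z p = z 0 then (if p = 0 then 1 / 2 else 1) * ∏ c, halfRising #{i | z (Fin.succ i) = c}
          else 0 := by
      intro p
      rw [← ih (fun i => z i.succ), Finset.sum_filter]
      by_cases hp : z p = z 0
      · simp only [hp, true_and, if_true]
        rw [Finset.mul_sum]
        refine Finset.sum_congr rfl fun e _ => ?_
        by_cases he : ∀ i, z (e i).succ = z i.succ
        · rw [if_pos he, if_pos he]
          split_ifs
          · push_cast; rw [one_div, mul_inv]; ring
          · simp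
        · rw [if_neg he, if_neg he, mul_zero]
      · simp [hp]
    simp only [h1]
    -- The term `p = 0` gives 1/2; the remaining ones count the later points with the colour of `0`.
    rw [Fin.sum_univ_succ]
    simp only [if_true, Fin.succ_ne_zero, if_false, one_mul]
    rw [← Finset.sum_filter, Finset.sum_const, nsmul_eq_mul, ← add_mul,
      Fintype.prod_eq_mul_prod_compl (z 0), Fintype.prod_eq_mul_prod_compl (z 0)
        (fun c => halfRising #{i | z i = c})]
    have h2 : #{i | z i = z 0} = #{i : Fin n | z i.succ = z 0} + 1 := by
      rw [Fin.univ_succ, Finset.filter_cons, if_pos rfl]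
      simp [Finset.filter_map]
    have h3 : ∀ c ∈ ({z 0} : Finset C)ᶜ, halfRising #{i | z i = c} =
        halfRising #{i : Fin n | z i.succ = c} := by
      intro c hc
      have hc : ¬ z 0 = c := by simpa [eq_comm] using hc
      rw [Fin.univ_succ, Finset.filter_cons, if_neg hc]
      simp [Finset.filter_map]
    rw [Finset.prod_congr rfl h3, h2, halfRising_succ]
    ring

open Finset in
theorem card_stabilizer_word {n : ℕ} {C : Type*} [Fintype C] [DecidableEq C] (x : Word n C) :
    Nat.card (MulAction.stabilizer (Equiv.Perm (Fin n)) x) = ∏ c, (#{i | x i = c}).factorial := by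
  have h := DomMulAct.stabilizer_card x
  simp only [Fintype.card_subtype] at h
  rw [← h, ← Fintype.card_subtype, ← Nat.card_eq_fintype_card]
  refine Nat.card_congr ⟨fun s => ⟨s.1⁻¹, ?_⟩, fun s => ⟨s.1⁻¹, ?_⟩, fun s => ?_, fun s => ?_⟩
  · exact MulAction.mem_stabilizer_iff.1 s.2
  · rw [MulAction.mem_stabilizer_iff]
    change x ∘ ⇑(s.1⁻¹⁻¹) = x
    rw [inv_inv]
    exact s.2
  · simp
  · simp

theorem mem_stabilizer_word_iff {n : ℕ} {C : Type*} (x : Word n C) (s : Equiv.Perm (Fin n)) :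
    s ∈ MulAction.stabilizer (Equiv.Perm (Fin n)) x ↔ ∀ i, x (s i) = x i := by
  rw [MulAction.mem_stabilizer_iff]
  constructor
  · intro h i
    have := congrFun h (s i)
    change x (s⁻¹ (s i)) = _ at this
    simpa using this.symm
  · intro h
    funext i
    change x (s⁻¹ i) = _
    simpa using (h (s⁻¹ i)).symm

theorem card_fixedBy_word {n : ℕ} (s : Equiv.Perm (Fin n)) :
    Nat.card (MulAction.fixedBy (Word n (Fin 2)) s) = fixedWords s := by
  refine Nat.card_congr (Equiv.subtypeEquivRight fun w => ?_)
  rw [MulAction.mem_fixedBy]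
  exact mem_stabilizer_word_iff w s

-- The permutations fixing both words are those preserving the colouring `i ↦ (x i, y i)`, with four
-- colours.
open Finset in
theorem burnsideKernel_word {n : ℕ} (x y : Word n (Fin 2)) :
    (burnsideKernel (Equiv.Perm (Fin n)) (Word n (Fin 2)) x y : ℂ) =
      ∏ a, (∏ b, halfRising #{i | x i = a ∧ y i = b}) / ((#{i | x i = a}).factorial : ℂ) := by
  unfold burnsideKernel
  have h := sum_inv_fixedWords n (fun i => (x i, y i))
  rw [card_stabilizer_word]
  simp only [card_fixedBy_word, mem_stabilizer_word_iff]
  simp only [Prod.mk.injEq, Fintype.prod_prod_type] at h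
  push_cast
  rw [Finset.prod_div_distrib, ← h, mul_comm, mul_one_div]
  congr 1
  refine Finset.sum_congr ?_ fun _ _ => rfl
  ext s
  simp [forall_and]

/-! ### Moments of arcsine variables and of their difference. -/

section Arcsine

open MvPolynomial

/-- The moments `binom(2a, a) / 4 ^ a` of the arcsine distribution on `[0, 1]`. -/
noncomputable def arcsineMoment (a : ℕ) : ℂ := halfRising a / (a.factorial : ℂ)

theorem arcsineMoment_zero : arcsineMoment 0 = 1 := by simp [arcsineMoment, halfRising_zero]

theorem arcsineMoment_succ (a : ℕ) :
    (a + 1) * arcsineMoment (a + 1) = (1 / 2 + a) * arcsineMoment a := by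
  unfold arcsineMoment
  rw [halfRising_succ, Nat.factorial_succ]
  have h1 : (a.factorial : ℂ) ≠ 0 := by exact_mod_cast a.factorial_ne_zero
  have h2 : (a + 1 : ℂ) ≠ 0 := by exact_mod_cast a.succ_ne_zero
  push_cast
  field_simp

/-- The expectation of a polynomial in two independent arcsine variables. -/
noncomputable def arcsineExp : MvPolynomial (Fin 2) ℂ →ₗ[ℂ] ℂ :=
  -- The expectation is a formal linear functional prescribed on monomials, so no integral is
  -- needed.
  (MvPolynomial.basisMonomials (Fin 2) ℂ).constr ℂ
    fun s => arcsineMoment (s 0) * arcsineMoment (s 1)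


theorem arcsineExp_monomial (s : Fin 2 →₀ ℕ) (c : ℂ) :
    arcsineExp (monomial s c) = c * (arcsineMoment (s 0) * arcsineMoment (s 1)) := by
  have h : arcsineExp (monomial s 1) = arcsineMoment (s 0) * arcsineMoment (s 1) := by
    have := (MvPolynomial.basisMonomials (Fin 2) ℂ).constr_basis ℂ
      (fun s => arcsineMoment (s 0) * arcsineMoment (s 1)) s
    rwa [MvPolynomial.coe_basisMonomials] at this
  rw [← h, ← smul_eq_mul, ← map_smul, smul_monomial, smul_eq_mul, mul_one]

theorem arcsineExp_X_pow (a b : ℕ) :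
    arcsineExp (X 0 ^ a * X 1 ^ b) = arcsineMoment a * arcsineMoment b := by
  rw [X_pow_eq_monomial, X_pow_eq_monomial, monomial_mul, arcsineExp_monomial]
  simp

theorem arcsineExp_C_mul (c : ℂ) (p : MvPolynomial (Fin 2) ℂ) :
    arcsineExp (C c * p) = c * arcsineExp p := by
  rw [← smul_eq_C_mul, map_smul, smul_eq_mul]

/-- The moments `E[θ ^ a (1 - θ) ^ b]` of the arcsine distribution. -/
noncomputable def arcsineBeta (a b : ℕ) : ℂ :=
  halfRising a * halfRising b / ((a + b).factorial : ℂ)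

theorem arcsineBeta_zero_right (a : ℕ) : arcsineBeta a 0 = arcsineMoment a := by
  simp [arcsineBeta, arcsineMoment, halfRising_zero]

theorem arcsineBeta_succ_right (a b : ℕ) :
    arcsineBeta a (b + 1) = arcsineBeta a b - arcsineBeta (a + 1) b := by
  unfold arcsineBeta
  rw [halfRising_succ, halfRising_succ, ← add_assoc, Nat.factorial_succ, add_right_comm a 1 b,
    Nat.factorial_succ]
  have h1 : ((a + b).factorial : ℂ) ≠ 0 := by exact_mod_cast (a + b).factorial_ne_zero
  have h2 : (a + b + 1 : ℂ) ≠ 0 := by exact_mod_cast (a + b).succ_ne_zero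
  push_cast
  field_simp
  ring

/-- Both sides satisfy the recursion coming from `1 - θ` times a monomial, which lowers the
exponents `d` and `b` to zero. -/
theorem arcsineExp_beta (a b c d : ℕ) :
    arcsineExp (X 0 ^ a * (1 - X 0) ^ b * (X 1 ^ c * (1 - X 1) ^ d)) =
      arcsineBeta a b * arcsineBeta c d := by
  induction d generalizing c with
  | succ d ih =>
    have h : (X 0 ^ a * (1 - X 0) ^ b * (X 1 ^ c * (1 - X 1) ^ (d + 1)) :
        MvPolynomial (Fin 2) ℂ) = X 0 ^ a * (1 - X 0) ^ b * (X 1 ^ c * (1 - X 1) ^ d) -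
          X 0 ^ a * (1 - X 0) ^ b * (X 1 ^ (c + 1) * (1 - X 1) ^ d) := by ring
    rw [h, map_sub, ih, ih, arcsineBeta_succ_right c d]
    ring
  | zero =>
    rw [pow_zero, mul_one, arcsineBeta_zero_right]
    induction b generalizing a with
    | zero => rw [pow_zero, mul_one, arcsineExp_X_pow, arcsineBeta_zero_right]
    | succ b ih =>
      have h : (X 0 ^ a * (1 - X 0) ^ (b + 1) * X 1 ^ c : MvPolynomial (Fin 2) ℂ) =
          X 0 ^ a * (1 - X 0) ^ b * X 1 ^ c - X 0 ^ (a + 1) * (1 - X 0) ^ b * X 1 ^ c := by ring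
      rw [h, map_sub, ih, ih, arcsineBeta_succ_right a b]
      ring

/-- Integration by parts against the arcsine density. -/
theorem arcsineExp_stein (i : Fin 2) (p : MvPolynomial (Fin 2) ℂ) :
    arcsineExp ((X i - X i ^ 2) * pderiv i p) = arcsineExp ((X i - C (1 / 2)) * p) := by
  -- For the density proportional to `(θ(1-θ))^(-1/2)`, the derivative of `θ(1-θ)` times the density
  -- is `1/2 - θ` times the density. On monomials this is the recursion `arcsineMoment_succ`.
  induction p using MvPolynomial.induction_on' with
  | add p q hp hq => rw [map_add, mul_add, mul_add, map_add, map_add, hp, hq]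
  | monomial s c =>
    have hs : monomial s c = C c * (X 0 ^ s 0 * X 1 ^ s 1) := by
      rw [monomial_eq]
      congr 1
      rw [Finsupp.prod_fintype _ _ (by simp), Fin.prod_univ_two]
    rw [hs, pderiv_C_mul, ← mul_assoc, mul_comm _ (C c), mul_assoc, arcsineExp_C_mul,
      mul_left_comm, arcsineExp_C_mul]
    congr 1
    generalize s 0 = a
    generalize s 1 = b
    have key : ∀ a : ℕ, (a : ℂ) * (arcsineMoment a - arcsineMoment (a + 1)) =
        arcsineMoment (a + 1) - 1 / 2 * arcsineMoment a := by
      intro a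
      linear_combination (-1 : ℂ) * arcsineMoment_succ a
    fin_cases i
    · have h1 : ((X 0 - X 0 ^ 2) * pderiv 0 (X 0 ^ a * X 1 ^ b) : MvPolynomial (Fin 2) ℂ) =
          C (a : ℂ) * (X 0 ^ a * X 1 ^ b - X 0 ^ (a + 1) * X 1 ^ b) := by
        rw [Derivation.leibniz, pderiv_pow, pderiv_pow, pderiv_X_self,
          pderiv_X_of_ne (by decide : (1 : Fin 2) ≠ 0)]
        rcases a with _ | a
        · simp
        · simp only [Nat.add_sub_cancel, smul_eq_mul, map_natCast]
          ring
      have h2 : ((X 0 - C (1 / 2)) * (X 0 ^ a * X 1 ^ b) : MvPolynomial (Fin 2) ℂ) =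
          X 0 ^ (a + 1) * X 1 ^ b - C (1 / 2) * (X 0 ^ a * X 1 ^ b) := by ring
      change arcsineExp ((X 0 - X 0 ^ 2) * pderiv 0 (X 0 ^ a * X 1 ^ b)) =
        arcsineExp ((X 0 - C (1 / 2)) * (X 0 ^ a * X 1 ^ b))
      rw [h1, h2, arcsineExp_C_mul, map_sub, map_sub, arcsineExp_C_mul]
      simp only [arcsineExp_X_pow]
      linear_combination arcsineMoment b * key a
    · have h1 : ((X 1 - X 1 ^ 2) * pderiv 1 (X 0 ^ a * X 1 ^ b) : MvPolynomial (Fin 2) ℂ) =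
          C (b : ℂ) * (X 0 ^ a * X 1 ^ b - X 0 ^ a * X 1 ^ (b + 1)) := by
        rw [Derivation.leibniz, pderiv_pow, pderiv_pow, pderiv_X_self,
          pderiv_X_of_ne (by decide : (0 : Fin 2) ≠ 1)]
        rcases b with _ | b
        · simp
        · simp only [Nat.add_sub_cancel, smul_eq_mul, map_natCast]
          ring
      have h2 : ((X 1 - C (1 / 2)) * (X 0 ^ a * X 1 ^ b) : MvPolynomial (Fin 2) ℂ) =
          X 0 ^ a * X 1 ^ (b + 1) - C (1 / 2) * (X 0 ^ a * X 1 ^ b) := by ring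
      change arcsineExp ((X 1 - X 1 ^ 2) * pderiv 1 (X 0 ^ a * X 1 ^ b)) =
        arcsineExp ((X 1 - C (1 / 2)) * (X 0 ^ a * X 1 ^ b))
      rw [h1, h2, arcsineExp_C_mul, map_sub, map_sub, arcsineExp_C_mul]
      simp only [arcsineExp_X_pow]
      linear_combination arcsineMoment a * key b

/-- The moments of the difference of two independent arcsine variables. -/
noncomputable def differenceMoment (l : ℕ) : ℂ := arcsineExp ((X 0 - X 1) ^ l)

theorem differenceMoment_zero : differenceMoment 0 = 1 := by
  have := arcsineExp_X_pow 0 0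
  simpa [differenceMoment, arcsineMoment_zero] using this

theorem differenceMoment_one : differenceMoment 1 = 0 := by
  have h1 := arcsineExp_X_pow 1 0
  have h2 := arcsineExp_X_pow 0 1
  simp only [pow_one, pow_zero, mul_one, one_mul] at h1 h2
  rw [differenceMoment, pow_one, map_sub, h1, h2]
  ring

/-- With `D = θ - φ` and `S = θ + φ - 1`, integration by parts in both variables is applied to
`D^(l+1)` (and subtracted) and to `S D^l` (and added). This gives two linear relations among the
expectations of `D^(l+2)`, `D^l` and `S² D^l`; the last is eliminated. -/
theorem differenceMoment_add_two (l : ℕ) :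
    (l + 2) ^ 2 * differenceMoment (l + 2) = (l + 1) ^ 2 * differenceMoment l := by
  have d0 : ∀ k : ℕ, pderiv (0 : Fin 2) ((X 0 - X 1) ^ k : MvPolynomial (Fin 2) ℂ) =
      C (k : ℂ) * (X 0 - X 1) ^ (k - 1) := by
    intro k
    rw [pderiv_pow, map_sub, pderiv_X_self, pderiv_X_of_ne (by decide : (1 : Fin 2) ≠ 0)]
    simp
  have d1 : ∀ k : ℕ, pderiv (1 : Fin 2) ((X 0 - X 1) ^ k : MvPolynomial (Fin 2) ℂ) =
      - (C (k : ℂ) * (X 0 - X 1) ^ (k - 1)) := by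
    intro k
    rw [pderiv_pow, map_sub, pderiv_X_self, pderiv_X_of_ne (by decide : (0 : Fin 2) ≠ 1)]
    simp
  have e0 : pderiv (0 : Fin 2) (X 0 + X 1 - 1 : MvPolynomial (Fin 2) ℂ) = 1 := by
    rw [map_sub, map_add, pderiv_X_self, pderiv_X_of_ne (by decide : (1 : Fin 2) ≠ 0)]
    simp
  have e1 : pderiv (1 : Fin 2) (X 0 + X 1 - 1 : MvPolynomial (Fin 2) ℂ) = 1 := by
    rw [map_sub, map_add, pderiv_X_self, pderiv_X_of_ne (by decide : (0 : Fin 2) ≠ 1)]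
    simp
  have hC : (C (1 / 2 : ℂ) : MvPolynomial (Fin 2) ℂ) * 2 = 1 := by
    have : (2 : MvPolynomial (Fin 2) ℂ) = C 2 := (map_ofNat C 2).symm
    rw [this, ← C_mul]
    norm_num
  set D : MvPolynomial (Fin 2) ℂ := X 0 - X 1 with hD
  set S : MvPolynomial (Fin 2) ℂ := X 0 + X 1 - 1 with hS
  set h : MvPolynomial (Fin 2) ℂ := C (1 / 2) with hh
  have s1 := arcsineExp_stein 0 (D ^ (l + 1))
  have s2 := arcsineExp_stein 1 (D ^ (l + 1))
  have s3 := arcsineExp_stein 0 (S * D ^ l)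
  have s4 := arcsineExp_stein 1 (S * D ^ l)
  rw [d0] at s1
  rw [d1] at s2
  rw [Derivation.leibniz, d0, e0] at s3
  rw [Derivation.leibniz, d1, e1] at s4
  rw [Nat.add_sub_cancel] at s1 s2
  simp only [smul_eq_mul] at s3 s4
  have a1 := congrArg₂ (· - ·) s1 s2
  have a2 := congrArg₂ (· + ·) s3 s4
  simp only [← map_sub, ← map_add] at a1 a2
  have p1 : (X 0 - X 0 ^ 2) * (C ((l + 1 : ℕ) : ℂ) * D ^ l) -
      (X 1 - X 1 ^ 2) * -(C ((l + 1 : ℕ) : ℂ) * D ^ l) =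
      C ((l + 1 : ℕ) : ℂ) * (h * D ^ l - h * D ^ (l + 2) - h * (S ^ 2 * D ^ l)) := by
    rw [pow_add D l 2, hD, hS]
    linear_combination (-(C ((l + 1 : ℕ) : ℂ) * (X 0 - X 1) ^ l *
      (X 0 + X 1 - X 0 ^ 2 - X 1 ^ 2))) * hC
  have p2 : (X 0 - h) * D ^ (l + 1) - (X 1 - h) * D ^ (l + 1) = D ^ (l + 2) := by
    rw [hD]; ring
  have p3 : (X 0 - X 0 ^ 2) * (S * (C (l : ℂ) * D ^ (l - 1)) + D ^ l * 1) +
      (X 1 - X 1 ^ 2) * (S * -(C (l : ℂ) * D ^ (l - 1)) + D ^ l * 1) =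
      h * D ^ l - h * D ^ (l + 2) - h * (S ^ 2 * D ^ l) - C (l : ℂ) * (S ^ 2 * D ^ l) := by
    rw [pow_add D l 2]
    -- For `l = 0` the exponent `l - 1` is truncated, but the coefficient `l` vanishes.
    have hl : C (l : ℂ) * (D * D ^ (l - 1)) = C (l : ℂ) * D ^ l := by
      rcases l with _ | l
      · simp
      · rw [Nat.add_sub_cancel, pow_succ' D l]
    have hAB : (X 0 - X 0 ^ 2) - (X 1 - X 1 ^ 2) = - (S * D) := by rw [hS, hD]; ring
    have hAB' : (X 0 - X 0 ^ 2) + (X 1 - X 1 ^ 2) = h * (1 - D ^ 2 - S ^ 2) := by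
      rw [hS, hD]
      linear_combination (-(X 0 + X 1 - X 0 ^ 2 - X 1 ^ 2)) * hC
    linear_combination S * (C (l : ℂ) * D ^ (l - 1)) * hAB + D ^ l * hAB' - S ^ 2 * hl
  have p4 : (X 0 - h) * (S * D ^ l) + (X 1 - h) * (S * D ^ l) = S ^ 2 * D ^ l := by
    rw [hS]
    linear_combination (-((X 0 + X 1 - 1) * D ^ l)) * hC
  rw [p1, p2] at a1
  rw [p3, p4] at a2
  simp only [hh, arcsineExp_C_mul, map_sub] at a1 a2
  change ((l : ℂ) + 2) ^ 2 * arcsineExp (D ^ (l + 2)) = ((l : ℂ) + 1) ^ 2 * arcsineExp (D ^ l)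
  push_cast at a1
  linear_combination (-(2 * l + 3 : ℂ)) * a1 + ((l : ℂ) + 1) * a2

theorem differenceMoment_odd (k : ℕ) : differenceMoment (2 * k + 1) = 0 := by
  induction k with
  | zero => exact differenceMoment_one
  | succ k ih =>
    have h := differenceMoment_add_two (2 * k + 1)
    rw [ih, mul_zero] at h
    have h2 : (((2 * k + 1 : ℕ) : ℂ) + 2) ^ 2 ≠ 0 := pow_ne_zero _ (by
      exact_mod_cast (2 * k + 2).succ_ne_zero)
    exact (mul_eq_zero.1 h).resolve_left h2

theorem burnsideEigenvalue_succ (k : ℕ) :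
    (2 * k + 2) ^ 2 * burnsideEigenvalue (k + 1) = (2 * k + 1) ^ 2 * burnsideEigenvalue k := by
  have h : ((k : ℂ) + 1) * ((2 * (k + 1)).choose (k + 1) : ℂ) =
      2 * (2 * k + 1) * ((2 * k).choose k : ℂ) := by
    exact_mod_cast Nat.succ_mul_centralBinom_succ k
  unfold burnsideEigenvalue
  rw [show 4 * (k + 1) = 4 * k + 4 by ring, pow_add]
  have h2 : (2 : ℂ) ^ (4 * k) ≠ 0 := pow_ne_zero _ two_ne_zero
  field_simp
  have h3 := congrArg (· ^ 2) h
  simp only [mul_pow] at h3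
  linear_combination h3

theorem differenceMoment_even (k : ℕ) : differenceMoment (2 * k) = burnsideEigenvalue k := by
  induction k with
  | zero => simp [differenceMoment_zero, burnsideEigenvalue]
  | succ k ih =>
    have h := differenceMoment_add_two (2 * k)
    have h' := burnsideEigenvalue_succ k
    rw [ih] at h
    push_cast at h
    rw [← h'] at h
    refine mul_left_cancel₀ (pow_ne_zero 2 ?_) h
    exact_mod_cast (2 * k + 1).succ_ne_zero

theorem burnsideEigenvalue_ne_zero (k : ℕ) : burnsideEigenvalue k ≠ 0 := by
  unfold burnsideEigenvalue
  have : ((2 * k).choose k : ℂ) ≠ 0 := by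
    exact_mod_cast (Nat.choose_pos (by omega)).ne'
  exact div_ne_zero (pow_ne_zero _ this) (pow_ne_zero _ two_ne_zero)

/-- The ratio of consecutive terms is `((2k+1)/(2k+2))² < 1`, so the sequence is strictly
decreasing; the order lives on the reals. -/
theorem burnsideEigenvalue_injective : Function.Injective burnsideEigenvalue := by
  have h : ∀ k, burnsideEigenvalue k =
      (((((2 * k).choose k : ℝ)) ^ 2 / 2 ^ (4 * k) : ℝ) : ℂ) := by
    intro k
    simp [burnsideEigenvalue]
  have hanti : StrictAnti fun k : ℕ => (((2 * k).choose k : ℝ)) ^ 2 / 2 ^ (4 * k) := by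
    refine strictAnti_nat_of_succ_lt fun k => ?_
    have h1 := burnsideEigenvalue_succ k
    rw [h, h] at h1
    have h2 : (2 * (k : ℝ) + 2) ^ 2 * (((2 * (k + 1)).choose (k + 1) : ℝ) ^ 2 /
        2 ^ (4 * (k + 1))) =
        (2 * (k : ℝ) + 1) ^ 2 * (((2 * k).choose k : ℝ) ^ 2 / 2 ^ (4 * k)) := by
      exact_mod_cast h1
    have h3 : 0 < (((2 * k).choose k : ℝ)) ^ 2 / 2 ^ (4 * k) := by
      have : (0 : ℝ) < ((2 * k).choose k : ℝ) := by exact_mod_cast Nat.choose_pos (by omega)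
      positivity
    have h4 : (2 * (k : ℝ) + 1) ^ 2 < (2 * (k : ℝ) + 2) ^ 2 := by
      have : (0 : ℝ) ≤ k := k.cast_nonneg
      nlinarith
    by_contra hle
    rw [not_lt] at hle
    have h5 : 0 < (2 * (k : ℝ) + 2) ^ 2 := by positivity
    nlinarith [mul_le_mul_of_nonneg_left hle h5.le, mul_lt_mul_of_pos_right h4 h3]
  intro a b hab
  rw [h, h] at hab
  exact hanti.injective (Complex.ofReal_injective hab)

/-! ### The Burnside matrix as an expected tensor power, and its triangular form. -/

/-- The tensor power of a `2 × 2` matrix, with rows and columns indexed by binary words. -/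
def tensorPow {R : Type*} [CommSemiring R] (n : ℕ) (N : Matrix (Fin 2) (Fin 2) R) :
    Matrix (Word n (Fin 2)) (Word n (Fin 2)) R :=
  Matrix.of fun x y => ∏ i, N (x i) (y i)

theorem tensorPow_mul {R : Type*} [CommSemiring R] (n : ℕ) (N N' : Matrix (Fin 2) (Fin 2) R) :
    tensorPow n (N * N') = tensorPow n N * tensorPow n N' := by
  ext x y
  simp only [tensorPow, Matrix.of_apply, Matrix.mul_apply, ← Finset.prod_mul_distrib]
  rw [Finset.prod_univ_sum, Fintype.piFinset_univ]

theorem tensorPow_one {R : Type*} [CommSemiring R] (n : ℕ) :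
    tensorPow n (1 : Matrix (Fin 2) (Fin 2) R) = 1 := by
  ext x y
  simp only [tensorPow, Matrix.of_apply, Matrix.one_apply]
  rw [Finset.prod_ite_zero]
  simp [funext_iff]

theorem tensorPow_map {R S : Type*} [CommSemiring R] [CommSemiring S] (φ : R →+* S) (n : ℕ)
    (N : Matrix (Fin 2) (Fin 2) R) : tensorPow n (N.map φ) = (tensorPow n N).map φ := by
  ext x y
  simp [tensorPow]

/-- The number of ones in a binary word. -/
def weight {n : ℕ} (x : Word n (Fin 2)) : ℕ := ∑ i, (x i : ℕ)

/-- The transition matrix of one letter: a zero becomes zero with probability `θ`, and a one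
with probability `φ`, where `θ` and `φ` are the variables. -/
noncomputable def letterMatrix : Matrix (Fin 2) (Fin 2) (MvPolynomial (Fin 2) ℂ) :=
  !![X 0, 1 - X 0; X 1, 1 - X 1]

/-- The triangular form of `letterMatrix` in the basis `(1, 1), (1, -1)`. -/
noncomputable def letterTriangular : Matrix (Fin 2) (Fin 2) (MvPolynomial (Fin 2) ℂ) :=
  !![1, X 0 + X 1 - 1; 0, X 0 - X 1]

/-- The change of basis that triangularizes `letterMatrix`. -/
def hadamard : Matrix (Fin 2) (Fin 2) ℂ := !![1, 1; 1, -1]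

/-- The rows of `letterMatrix` sum to one, so `(1, 1)` is an eigenvector. Since the change of basis
is constant, it passes through the expectation. -/
theorem letterMatrix_mul_hadamard :
    letterMatrix * hadamard.map C = hadamard.map C * letterTriangular := by
  ext1 i j
  fin_cases i <;> fin_cases j <;>
    simp [letterMatrix, letterTriangular, hadamard, Matrix.mul_apply, Fin.sum_univ_two] <;> ring

theorem hadamard_mul_self : hadamard * ((1 / 2 : ℂ) • hadamard) = 1 := by
  ext1 i j
  fin_cases i <;> fin_cases j <;>
    simp [hadamard, Matrix.mul_apply, Fin.sum_univ_two] <;> norm_num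

theorem map_arcsineExp_mul_map_C {m : Type*} [Fintype m]
    (A : Matrix m m (MvPolynomial (Fin 2) ℂ)) (B : Matrix m m ℂ) :
    (A * B.map C).map arcsineExp = A.map arcsineExp * B := by
  ext x y
  simp only [Matrix.map_apply, Matrix.mul_apply, map_sum]
  refine Finset.sum_congr rfl fun z _ => ?_
  rw [mul_comm, arcsineExp_C_mul, mul_comm]

theorem map_arcsineExp_map_C_mul {m : Type*} [Fintype m]
    (A : Matrix m m (MvPolynomial (Fin 2) ℂ)) (B : Matrix m m ℂ) :
    (B.map C * A).map arcsineExp = B * A.map arcsineExp := by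
  ext x y
  simp only [Matrix.map_apply, Matrix.mul_apply, map_sum, arcsineExp_C_mul]

/-- The matrix of the binary Burnside operator. -/
noncomputable def burnsideMatrix (n : ℕ) : Matrix (Word n (Fin 2)) (Word n (Fin 2)) ℂ :=
  (tensorPow n letterMatrix).map arcsineExp

/-- A matrix similar to the binary Burnside matrix, and block triangular for the weight. -/
noncomputable def burnsideTriangular (n : ℕ) : Matrix (Word n (Fin 2)) (Word n (Fin 2)) ℂ :=
  (tensorPow n letterTriangular).map arcsineExp

theorem burnsideMatrix_mul_hadamard (n : ℕ) :
    burnsideMatrix n * tensorPow n hadamard = tensorPow n hadamard * burnsideTriangular n := by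
  unfold burnsideMatrix burnsideTriangular
  rw [← map_arcsineExp_mul_map_C, ← map_arcsineExp_map_C_mul, ← tensorPow_map, ← tensorPow_mul,
    letterMatrix_mul_hadamard, tensorPow_mul]

open Finset in
theorem tensorPow_letterMatrix {n : ℕ} (x y : Word n (Fin 2)) :
    tensorPow n letterMatrix x y =
      ∏ a, ∏ b, letterMatrix a b ^ #{i | x i = a ∧ y i = b} := by
  rw [← Fintype.prod_prod_type']
  simp only [tensorPow, Matrix.of_apply]
  rw [← Finset.prod_fiberwise univ (fun i => (x i, y i))]
  refine Finset.prod_congr rfl fun c _ => ?_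
  rw [Finset.prod_congr rfl (g := fun _ => letterMatrix c.1 c.2), Finset.prod_const]
  · simp only [Prod.ext_iff]
  · intro i hi
    simp only [mem_filter, mem_univ, true_and] at hi
    rw [← hi]

-- Grouping positions by the pair `(x i, y i)` turns the entry of the tensor power into `θ^a (1-θ)^b
-- φ^c (1-φ)^d`, whose expectation is the rising factorial formula for the kernel.
open Finset in
theorem burnsideMatrix_apply {n : ℕ} (x y : Word n (Fin 2)) :
    burnsideMatrix n x y =
      (burnsideKernel (Equiv.Perm (Fin n)) (Word n (Fin 2)) x y : ℂ) := by
  have hsplit : ∀ a : Fin 2,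
      #{i | x i = a} = #{i | x i = a ∧ y i = 0} + #{i | x i = a ∧ y i = 1} := by
    intro a
    rw [← Finset.card_union_of_disjoint]
    · congr 1
      ext i
      have : y i = 0 ∨ y i = 1 := by
        generalize y i = b
        fin_cases b <;> simp
      simp only [mem_filter, mem_univ, true_and, mem_union]
      tauto
    · rw [Finset.disjoint_filter]
      rintro i - ⟨-, h1⟩ ⟨-, h2⟩
      rw [h1] at h2
      exact absurd h2 (by decide)
  rw [burnsideMatrix, Matrix.map_apply, tensorPow_letterMatrix, burnsideKernel_word]
  simp only [Fin.prod_univ_two, hsplit]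
  have h := arcsineExp_beta #{i | x i = 0 ∧ y i = 0} #{i | x i = 0 ∧ y i = 1}
    #{i | x i = 1 ∧ y i = 0} #{i | x i = 1 ∧ y i = 1}
  simpa [letterMatrix, arcsineBeta] using h

theorem burnsideMatrix_mulVec {n : ℕ} (f : BinaryFun n) :
    (burnsideMatrix n).mulVec f = binaryBurnside n f := by
  funext x
  change ∑ y, burnsideMatrix n x y * f y = ∑ y, _ * f y
  simp only [burnsideMatrix_apply]

/-- An entry at `(x, y)` can be nonzero only if `x ≤ y` letterwise. When `y` has weight `w ≤ weight
x`, this leaves `y = x`, and the diagonal entry is `E[(θ-φ)^w]`. -/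
theorem burnsideTriangular_mulVec_of_weight {n w : ℕ} {f : BinaryFun n}
    (hf : ∀ x, weight x ≠ w → f x = 0) (x : Word n (Fin 2)) (hx : w ≤ weight x) :
    (burnsideTriangular n).mulVec f x = differenceMoment w * f x := by
  change ∑ y, burnsideTriangular n x y * f y = _
  rw [Finset.sum_eq_single x]
  · by_cases hw : weight x = w
    · congr 1
      rw [burnsideTriangular, Matrix.map_apply, differenceMoment, ← hw, weight,
        ← Finset.prod_pow_eq_pow_sum]
      congr 1
      simp only [tensorPow, Matrix.of_apply]
      refine Finset.prod_congr rfl fun i _ => ?_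
      generalize x i = a
      fin_cases a <;> simp [letterTriangular]
    · rw [hf x hw, mul_zero, mul_zero]
  · intro y _ hyx
    by_cases hy : weight y = w
    swap
    · rw [hf y hy, mul_zero]
    -- Otherwise `x ≤ y` letterwise, and comparing weights would give `x = y`.
    have h : ∃ i, x i = 1 ∧ y i = 0 := by
      by_contra hne
      push Not at hne
      have hle : ∀ i ∈ Finset.univ, (x i : ℕ) ≤ (y i : ℕ) := by
        intro i _
        have := hne i
        generalize x i = a at *
        generalize y i = b at *
        fin_cases a <;> fin_cases b <;> simp_all
      have heq : ∑ i, (x i : ℕ) = ∑ i, (y i : ℕ) :=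
        le_antisymm (Finset.sum_le_sum hle) (by rw [← weight, ← weight]; omega)
      rw [Finset.sum_eq_sum_iff_of_le hle] at heq
      exact hyx (funext fun i => Fin.ext (heq i (Finset.mem_univ i)).symm)
    obtain ⟨i, h1, h2⟩ := h
    have : tensorPow n letterTriangular x y = 0 := by
      simp only [tensorPow, Matrix.of_apply]
      refine Finset.prod_eq_zero (Finset.mem_univ i) ?_
      rw [h1, h2]
      simp [letterTriangular]
    rw [burnsideTriangular, Matrix.map_apply, this, map_zero, zero_mul]
  · simp

/-- A matrix on words that is invariant under permutations commutes with the permutations. -/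
theorem mulVec_binaryRep {n : ℕ} {A : Matrix (Word n (Fin 2)) (Word n (Fin 2)) ℂ}
    (hA : ∀ (s : Equiv.Perm (Fin n)) (x y), A (s • x) (s • y) = A x y)
    (s : Equiv.Perm (Fin n)) (f : BinaryFun n) :
    A.mulVec (binaryRep n s f) = binaryRep n s (A.mulVec f) := by
  funext x
  change ∑ y, A x y * f (s⁻¹ • y) = ∑ y, A (s⁻¹ • x) y * f y
  rw [← Equiv.sum_comp (MulAction.toPerm s)]
  refine Finset.sum_congr rfl fun y _ => ?_
  have h := hA s (s⁻¹ • x) y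
  rw [smul_inv_smul] at h
  rw [MulAction.toPerm_apply, inv_smul_smul, h]

theorem tensorPow_smul_smul {R : Type*} [CommSemiring R] {n : ℕ} (N : Matrix (Fin 2) (Fin 2) R)
    (s : Equiv.Perm (Fin n)) (x y : Word n (Fin 2)) :
    tensorPow n N (s • x) (s • y) = tensorPow n N x y :=
  Equiv.prod_comp s⁻¹ fun i => N (x i) (y i)

end Arcsine

/-! ### The action of `sl₂`, its commutation with permutations, and its weights. -/

section LieAction

attribute [local instance] LieRing.ofAssociativeRing

/-- A `2 × 2` matrix acting in position `i` of `(ℂ²)^{⊗ n}`. -/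
def letterAction {n : ℕ} (i : Fin n) :
    Matrix (Fin 2) (Fin 2) ℂ →ₗ[ℂ] Module.End ℂ (BinaryFun n) where
  toFun N :=
    { toFun := fun f x => ∑ b, N (x i) b * f (Function.update x i b)
      map_add' := fun f g => by funext x; simp [mul_add, Finset.sum_add_distrib]
      map_smul' := fun c f => by
        funext x
        simp only [Pi.smul_apply, smul_eq_mul, RingHom.id_apply, Finset.mul_sum, mul_left_comm] }
  map_add' N N' := by
    refine LinearMap.ext fun f => ?_
    funext x
    simp [add_mul, Finset.sum_add_distrib]
  map_smul' c N := by
    refine LinearMap.ext fun f => ?_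
    funext x
    simp [mul_assoc, mul_add]

theorem letterAction_apply {n : ℕ} (i : Fin n) (N : Matrix (Fin 2) (Fin 2) ℂ) (f : BinaryFun n)
    (x : Word n (Fin 2)) :
    letterAction i N f x = ∑ b, N (x i) b * f (Function.update x i b) := rfl

theorem letterAction_mul {n : ℕ} (i : Fin n) (N N' : Matrix (Fin 2) (Fin 2) ℂ) :
    letterAction i (N * N') = letterAction i N * letterAction i N' := by
  refine LinearMap.ext fun f => ?_
  funext x
  simp only [Module.End.mul_apply, letterAction_apply, Function.update_self,
    Function.update_idem, Matrix.mul_apply, Finset.sum_mul, Finset.mul_sum]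
  rw [Finset.sum_comm]
  simp only [mul_assoc]

theorem letterAction_commute {n : ℕ} {i j : Fin n} (hij : i ≠ j)
    (N N' : Matrix (Fin 2) (Fin 2) ℂ) :
    letterAction i N * letterAction j N' = letterAction j N' * letterAction i N := by
  refine LinearMap.ext fun f => ?_
  funext x
  simp only [Module.End.mul_apply, letterAction_apply, Function.update_of_ne hij,
    Function.update_of_ne hij.symm, Finset.mul_sum]
  rw [Finset.sum_comm]
  refine Finset.sum_congr rfl fun b _ => Finset.sum_congr rfl fun c _ => ?_
  rw [Function.update_comm hij]
  ring

theorem sl2Action_eq_sum (n : ℕ) (A : sl2) : sl2Action n A = ∑ i, letterAction i A.1 := by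
  refine LinearMap.ext fun f => ?_
  funext x
  rw [LinearMap.sum_apply, Finset.sum_apply]
  rfl

/-- The action of `sl₂` on `L(C₂ⁿ)` as a homomorphism of Lie algebras. -/
def sl2ActionHom (n : ℕ) : sl2 →ₗ⁅ℂ⁆ Module.End ℂ (BinaryFun n) where
  toFun := sl2Action n
  map_add' A B := by
    simp only [sl2Action_eq_sum, ← Finset.sum_add_distrib]
    exact Finset.sum_congr rfl fun i _ => map_add (letterAction i) A.1 B.1
  map_smul' c A := by
    simp only [sl2Action_eq_sum, Finset.smul_sum]
    exact Finset.sum_congr rfl fun i _ => map_smul (letterAction i) c A.1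
  map_lie' {A B} := by
    simp only [sl2Action_eq_sum]
    -- Actions in different positions commute, so only the diagonal terms of the double sum survive
    -- in the commutator.
    rw [Ring.lie_def, Finset.sum_mul_sum, Finset.sum_mul_sum, Finset.sum_comm,
      ← Finset.sum_sub_distrib]
    refine Finset.sum_congr rfl fun i _ => ?_
    rw [← Finset.sum_sub_distrib, Finset.sum_eq_single i]
    · rw [← letterAction_mul, ← letterAction_mul, ← map_sub]
      rfl
    · intro j _ hj
      rw [letterAction_commute hj, sub_self]
    · simp

instance binaryLieRingModule (n : ℕ) : LieRingModule sl2 (BinaryFun n) :=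
  LieRingModule.compLieHom (BinaryFun n) (sl2ActionHom n)

instance binaryLieModule (n : ℕ) : LieModule ℂ sl2 (BinaryFun n) :=
  LieModule.compLieHom (BinaryFun n) (sl2ActionHom n)

theorem lie_binaryFun {n : ℕ} (A : sl2) (f : BinaryFun n) : ⁅A, f⁆ = sl2Action n A f := rfl

theorem smul_update {n : ℕ} {C : Type*} (s : Equiv.Perm (Fin n)) (x : Word n C) (i : Fin n)
    (b : C) : s • (Function.update x i b : Word n C) = Function.update (s • x) (s i) b := by
  funext j
  change Function.update x i b (s⁻¹ j) = Function.update (fun j => x (s⁻¹ j)) (s i) b j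
  by_cases h : j = s i
  · subst h; simp
  · rw [Function.update_of_ne h, Function.update_of_ne]
    rintro rfl
    simp at h

theorem sl2Action_binaryRep {n : ℕ} (A : sl2) (s : Equiv.Perm (Fin n)) (f : BinaryFun n) :
    sl2Action n A (binaryRep n s f) = binaryRep n s (sl2Action n A f) := by
  funext x
  change ∑ i, ∑ b, A.1 (x i) b * f (s⁻¹ • Function.update x i b) =
    ∑ i, ∑ b, A.1 ((s⁻¹ • x) i) b * f (Function.update (s⁻¹ • x) i b)
  rw [← Equiv.sum_comp s⁻¹ (fun i => ∑ b, A.1 ((s⁻¹ • x) i) b * f (Function.update (s⁻¹ • x) i b))]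
  refine Finset.sum_congr rfl fun i _ => Finset.sum_congr rfl fun b _ => ?_
  rw [smul_update]
  congr 2
  refine congrFun (congrArg A.1 ?_) b
  change x i = x (s⁻¹⁻¹ (s⁻¹ i))
  simp

/-- The diagonal element of the standard basis of `sl₂`. -/
def sl2H : sl2 := ⟨!![1, 0; 0, -1], by simp [LieAlgebra.SpecialLinear.sl, Matrix.trace_fin_two]⟩

/-- The raising element of the standard basis of `sl₂`. -/
def sl2E : sl2 := ⟨!![0, 1; 0, 0], by simp [LieAlgebra.SpecialLinear.sl, Matrix.trace_fin_two]⟩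

/-- The lowering element of the standard basis of `sl₂`. -/
def sl2F : sl2 := ⟨!![0, 0; 1, 0], by simp [LieAlgebra.SpecialLinear.sl, Matrix.trace_fin_two]⟩

theorem isSl2Triple_sl2 : IsSl2Triple sl2H sl2E sl2F where
  h_ne_zero h := by
    have := congrFun (congrFun (congrArg Subtype.val h) 0) 0
    simp [sl2H] at this
  lie_e_f := by
    apply Subtype.ext
    rw [LieSubalgebra.coe_bracket, Ring.lie_def]
    ext i j
    fin_cases i <;> fin_cases j <;> simp [sl2H, sl2E, sl2F]
  lie_h_e_nsmul := by
    apply Subtype.ext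
    rw [LieSubalgebra.coe_bracket, Ring.lie_def]
    ext i j
    fin_cases i <;> fin_cases j <;> simp [sl2H, sl2E, one_add_one_eq_two]
  lie_h_f_nsmul := by
    apply Subtype.ext
    rw [LieSubalgebra.coe_bracket, Ring.lie_def]
    ext i j
    fin_cases i <;> fin_cases j <;> norm_num [sl2H, sl2F]

theorem sl2Action_H {n : ℕ} (f : BinaryFun n) (x : Word n (Fin 2)) :
    sl2Action n sl2H f x = ((n : ℂ) - 2 * weight x) * f x := by
  change ∑ i, ∑ b, sl2H.1 (x i) b * f (Function.update x i b) = _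
  have h : ∀ i, ∑ b, sl2H.1 (x i) b * f (Function.update x i b) =
      (1 - 2 * ((x i : ℕ) : ℂ)) * f x := by
    intro i
    rw [Finset.sum_eq_single (x i)]
    · rw [Function.update_eq_self]
      congr 1
      generalize x i = a
      fin_cases a <;> norm_num [sl2H]
    · intro b _ hb
      have : sl2H.1 (x i) b = 0 := by
        generalize x i = a at *
        fin_cases a <;> fin_cases b <;> simp_all [sl2H]
      rw [this, zero_mul]
    · simp
  simp only [h]
  rw [← Finset.sum_mul, Finset.sum_sub_distrib, ← Finset.mul_sum, weight]
  simp

/-- The eigenvectors of `H` are the functions supported on words of a fixed weight. -/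
theorem lie_sl2H_eq_smul_iff {n : ℕ} (w : ℤ) (f : BinaryFun n) :
    ⁅sl2H, f⁆ = ((n : ℂ) - 2 * w) • f ↔ ∀ x, (weight x : ℤ) ≠ w → f x = 0 := by
  rw [lie_binaryFun, funext_iff]
  refine forall_congr' fun x => ?_
  rw [sl2Action_H, Pi.smul_apply, smul_eq_mul, ← sub_eq_zero, ← sub_mul, mul_eq_zero,
    or_iff_not_imp_left]
  refine imp_congr_left (not_congr ?_)
  constructor
  · intro h
    have h2 : (weight x : ℂ) = (w : ℂ) := by linear_combination (-1 / 2 : ℂ) * h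
    exact_mod_cast h2
  · intro h
    have : (weight x : ℂ) = (w : ℂ) := by exact_mod_cast h
    rw [this, sub_self]

end LieAction

/-! ### The multiplicity space of intertwining maps. -/

section Hom

variable {n : ℕ} {V : Type*} [AddCommGroup V] [Module ℂ V]
  {ρ : Representation ℂ (Equiv.Perm (Fin n)) V}

/-- Composition of intertwining maps with an operator that commutes with the permutations. -/
def compCommuting (ρ : Representation ℂ (Equiv.Perm (Fin n)) V) (A : Module.End ℂ (BinaryFun n))
    (hA : ∀ s f, A (binaryRep n s f) = binaryRep n s (A f)) :
    Module.End ℂ (ρ.IntertwiningMap (binaryRep n)) where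
  toFun φ := ⟨A ∘ₗ φ.toLinearMap, fun s => by
    ext1 v
    change A (φ (ρ s v)) = binaryRep n s (A (φ v))
    rw [φ.isIntertwining, hA]⟩
  map_add' φ ψ := by ext v : 2; exact map_add A (φ v) (ψ v)
  map_smul' c φ := by ext v : 2; exact map_smul A c (φ v)

theorem Representation.IntertwiningMap.ext_apply {φ ψ : ρ.IntertwiningMap (binaryRep n)}
    (h : ∀ v, φ v = ψ v) : φ = ψ := DFunLike.ext _ _ h

/-- `sl₂` acts on the multiplicity space of a representation of the symmetric group in
`L(C₂ⁿ)`. -/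
instance multiplicityLieRingModule : LieRingModule sl2 (ρ.IntertwiningMap (binaryRep n)) where
  bracket A φ := compCommuting ρ (sl2Action n A) (sl2Action_binaryRep A) φ
  add_lie A B φ := Representation.IntertwiningMap.ext_apply fun v => add_lie A B (φ v)
  lie_add A φ ψ := map_add (compCommuting ρ (sl2Action n A) _) φ ψ
  leibniz_lie A B φ := Representation.IntertwiningMap.ext_apply fun v => leibniz_lie A B (φ v)

theorem lie_intertwiningMap_apply (A : sl2) (φ : ρ.IntertwiningMap (binaryRep n)) (v : V) :
    ⁅A, φ⁆ v = ⁅A, φ v⁆ := rfl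

instance multiplicityLieModule : LieModule ℂ sl2 (ρ.IntertwiningMap (binaryRep n)) where
  smul_lie c A φ := Representation.IntertwiningMap.ext_apply fun v => smul_lie c A (φ v)
  lie_smul c A φ := map_smul (compCommuting ρ (sl2Action n A) _) c φ

theorem toEnd_pow_intertwiningMap_apply (A : sl2) (φ : ρ.IntertwiningMap (binaryRep n)) (i : ℕ)
    (v : V) : ((LieModule.toEnd ℂ sl2 _ A) ^ i) φ v =
      ((LieModule.toEnd ℂ sl2 (BinaryFun n) A) ^ i) (φ v) := by
  induction i with
  | zero => rfl
  | succ i ih =>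
    rw [pow_succ', pow_succ', Module.End.mul_apply, Module.End.mul_apply, ← ih]
    rfl

end Hom

/-! ### Polytabloids as generators of Specht modules. -/

section Tableau

variable {n : ℕ} {μ : YoungDiagram}

/-- The row of an entry of a tableau. -/
def Tableau.row (T : Tableau n μ) (p : Fin n) : ℕ := (T p).1.1

/-- The column of an entry of a tableau. -/
def Tableau.col (T : Tableau n μ) (p : Fin n) : ℕ := (T p).1.2

theorem Tableau.eq_of_row_col (T : Tableau n μ) {p q : Fin n} (h1 : T.row p = T.row q)
    (h2 : T.col p = T.col q) : p = q :=
  T.injective (Subtype.ext (Prod.ext h1 h2))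

theorem Tableau.functionRep_polytabloid_of_col (T : Tableau n μ) (s : Equiv.Perm (Fin n))
    (hs : ∀ p, T.col (s p) = T.col p) :
    functionRep (Equiv.Perm (Fin n)) (Word n ℕ) s T.polytabloid =
      ((Equiv.Perm.sign s : ℤ) : ℂ) • T.polytabloid := by
  unfold Tableau.polytabloid
  rw [map_sum, Finset.smul_sum]
  have hs' : ∀ p, T.col (s⁻¹ p) = T.col p := fun p => by simpa using (hs (s⁻¹ p)).symm
  refine Finset.sum_bij' (fun t _ => s * t) (fun t _ => s⁻¹ * t) ?_ ?_ ?_ ?_ ?_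
  · intro t ht
    simp only [Finset.mem_filter, Finset.mem_univ, true_and] at ht ⊢
    exact fun i => (hs (t i)).trans (ht i)
  · intro t ht
    simp only [Finset.mem_filter, Finset.mem_univ, true_and] at ht ⊢
    exact fun i => (hs' (t i)).trans (ht i)
  · intro t _; group
  · intro t _; group
  · intro t _
    rw [functionRep_single, smul_smul, ← Pi.single_smul, smul_eq_mul]
    congr 1
    rw [map_mul, Units.val_mul, ← Int.cast_mul, ← mul_assoc, ← Units.val_mul, Int.units_mul_self,
      Units.val_one, one_mul]

/-- A permutation that fixes every entry of the columns of length at least two and preserves the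
rows fixes the polytabloid. -/
theorem Tableau.functionRep_polytabloid_of_fixed (T : Tableau n μ) (g : Equiv.Perm (Fin n))
    (hrow : ∀ p, T.row (g p) = T.row p)
    (hg : ∀ p q, T.col p = T.col q → p ≠ q → g p = p) :
    functionRep (Equiv.Perm (Fin n)) (Word n ℕ) g T.polytabloid = T.polytabloid := by
  unfold Tableau.polytabloid
  rw [map_sum]
  refine Finset.sum_congr rfl fun s hs => ?_
  simp only [Finset.mem_filter, Finset.mem_univ, true_and] at hs
  rw [functionRep_single, smul_smul]
  -- A column permutation `s` moves only entries in columns of length at least two, all of which `g`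
  -- fixes.
  have hcomm : g * s = s * g := by
    ext1 p
    change g (s p) = s (g p)
    by_cases hp : s p = p
    · rw [hp]
      by_cases hq : s (g p) = g p
      · exact hq.symm
      · have h1 : g (g p) = g p := hg (g p) (s (g p)) (hs (g p)).symm (Ne.symm hq)
        have h2 : g p = p := g.injective h1
        rw [h2, hp]
    · rw [hg (s p) p (hs p) hp, hg p (s p) (hs p).symm (Ne.symm hp)]
  have htab : g • T.tabloid = T.tabloid := by
    funext p
    change T.row (g⁻¹ p) = T.row p
    simpa using (hrow (g⁻¹ p)).symm
  rw [hcomm, mul_smul, htab]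

theorem Tableau.polytabloid_tabloid (T : Tableau n μ) : T.polytabloid T.tabloid = 1 := by
  unfold Tableau.polytabloid
  rw [Finset.sum_apply, Finset.sum_eq_single 1]
  · simp
  · intro s hs h1
    simp only [Finset.mem_filter, Finset.mem_univ, true_and] at hs
    rw [Pi.single_apply, if_neg]
    intro h
    refine h1 (Equiv.ext fun p => T.eq_of_row_col ?_ (hs p))
    have := congrFun h (s p)
    change T.row (s p) = T.row (s⁻¹ (s p)) at this
    simpa using this
  · intro h
    simp at h

theorem Tableau.exists_smul_of_polytabloid_ne_zero (T : Tableau n μ) {z : Word n ℕ}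
    (hz : T.polytabloid z ≠ 0) : ∃ s : Equiv.Perm (Fin n), z = s • T.tabloid := by
  unfold Tableau.polytabloid at hz
  rw [Finset.sum_apply] at hz
  obtain ⟨s, -, hs⟩ := Finset.exists_ne_zero_of_sum_ne_zero hz
  refine ⟨s, ?_⟩
  by_contra h
  exact hs (by rw [Pi.single_apply, if_neg h])

theorem Tableau.polytabloid_eq_functionRep (T T' : Tableau n μ) :
    T'.polytabloid =
      functionRep (Equiv.Perm (Fin n)) (Word n ℕ) (T.trans T'.symm) T.polytabloid := by
  rw [T.functionRep_polytabloid]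
  congr 1
  ext1 p
  change T' p = T ((T.trans T'.symm).symm p)
  simp

/-- The polytabloid of a tableau as an element of the Specht module. -/
def Tableau.spechtVec (T : Tableau n μ) : Specht n μ :=
  ⟨T.polytabloid, Submodule.subset_span ⟨T, rfl⟩⟩

/-- The Specht module is generated by any polytabloid. -/
theorem Tableau.specht_induction (T : Tableau n μ) (U : Submodule ℂ (Specht n μ))
    (hU : ∀ g, spechtRep n μ g T.spechtVec ∈ U) : U = ⊤ := by
  rw [eq_top_iff]
  rintro ⟨v, hv⟩ -
  have h : Submodule.span ℂ (Set.range (Tableau.polytabloid (n := n) (μ := μ))) ≤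
      U.map (Submodule.subtype _) := by
    rw [Submodule.span_le]
    rintro _ ⟨T', rfl⟩
    exact ⟨_, hU (T.trans T'.symm), (T.polytabloid_eq_functionRep T').symm⟩
  obtain ⟨u, hu, hu'⟩ := h hv
  have : u = ⟨v, hv⟩ := Subtype.ext hu'
  rwa [← this]

theorem Tableau.intertwiningMap_ext (T : Tableau n μ) {V : Type*} [AddCommGroup V] [Module ℂ V]
    {ρ : Representation ℂ (Equiv.Perm (Fin n)) V} {φ ψ : (spechtRep n μ).IntertwiningMap ρ}
    (h : φ T.spechtVec = ψ T.spechtVec) : φ = ψ := by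
  have := T.specht_induction (LinearMap.eqLocus φ.toLinearMap ψ.toLinearMap) fun g => by
    change φ _ = ψ _
    rw [φ.isIntertwining, ψ.isIntertwining, h]
  refine DFunLike.ext _ _ fun v => ?_
  have hv : v ∈ (⊤ : Submodule ℂ (Specht n μ)) := trivial
  rw [← this] at hv
  exact hv

end Tableau

/-! ### Two-row shapes: at most one intertwining map per weight, up to scalars. -/

section TwoRow

variable {n m : ℕ} {hm : 2 * m ≤ n}

theorem mem_twoRow_iff {c : ℕ × ℕ} :
    c ∈ (twoRow n m hm).cells ↔ (c.1 = 0 ∧ c.2 < n - m) ∨ (c.1 = 1 ∧ c.2 < m) := by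
  rw [YoungDiagram.mem_cells, twoRow, YoungDiagram.mem_ofRowLens]
  obtain ⟨i, j⟩ := c
  rcases i with _ | _ | i <;> simp

theorem card_twoRow : (twoRow n m hm).cells.card = n := by
  have h : (twoRow n m hm).cells =
      ({0} : Finset ℕ) ×ˢ Finset.range (n - m) ∪ ({1} : Finset ℕ) ×ˢ Finset.range m := by
    ext c
    rw [mem_twoRow_iff]
    simp only [Finset.mem_union, Finset.mem_product, Finset.mem_singleton, Finset.mem_range]
  rw [h, Finset.card_union_of_disjoint]
  · simp
    omega
  · rw [Finset.disjoint_left]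
    rintro ⟨i, j⟩ h1 h2
    simp at h1 h2
    omega

theorem nonempty_tableau_twoRow : Nonempty (Tableau n (twoRow n m hm)) :=
  ⟨(Fintype.equivFinOfCardEq (by rw [Fintype.card_coe, card_twoRow])).symm⟩

variable (T : Tableau n (twoRow n m hm))

theorem Tableau.row_lt_two (p : Fin n) : T.row p < 2 := by
  have := mem_twoRow_iff.1 (T p).2
  unfold Tableau.row
  omega

theorem Tableau.row_eq_zero_of_le {p : Fin n} (hp : m ≤ T.col p) : T.row p = 0 := by
  have := mem_twoRow_iff.1 (T p).2
  unfold Tableau.row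
  unfold Tableau.col at hp
  omega

theorem Tableau.col_lt_of_eq_of_ne {p q : Fin n} (h : T.col p = T.col q) (hpq : p ≠ q) :
    T.col p < m := by
  by_contra hlt
  rw [not_lt] at hlt
  refine hpq (T.eq_of_row_col ?_ h)
  rw [T.row_eq_zero_of_le hlt, T.row_eq_zero_of_le (h ▸ hlt)]

theorem Tableau.exists_pair {j : ℕ} (hj : j < m) :
    ∃ p q, p ≠ q ∧ T.col p = j ∧ T.col q = j ∧ T.row p = 0 ∧ T.row q = 1 := by
  have h0 : ((0, j) : ℕ × ℕ) ∈ (twoRow n m hm).cells := mem_twoRow_iff.2 (Or.inl ⟨rfl, by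
    change j < n - m
    omega⟩)
  have h1 : ((1, j) : ℕ × ℕ) ∈ (twoRow n m hm).cells := mem_twoRow_iff.2 (Or.inr ⟨rfl, hj⟩)
  refine ⟨T.symm ⟨_, h0⟩, T.symm ⟨_, h1⟩, ?_, ?_, ?_, ?_, ?_⟩
  · rw [Ne, T.symm.injective.eq_iff]
    simp
  all_goals simp [Tableau.col, Tableau.row]

/-- A binary word is separated by a tableau if it takes different values on different entries of
each column. -/
def Tableau.Separates (x : Word n (Fin 2)) : Prop :=
  ∀ p q, T.col p = T.col q → p ≠ q → x p ≠ x q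

variable {T}

theorem Tableau.Separates.exists_eq {x : Word n (Fin 2)} (hx : T.Separates x) {j : ℕ} (hj : j < m)
    (b : Fin 2) : ∃ p, T.col p = j ∧ x p = b := by
  obtain ⟨p, q, hpq, hp, hq, -, -⟩ := T.exists_pair hj
  have h := hx p q (hp.trans hq.symm) hpq
  by_cases hb : x p = b
  · exact ⟨p, hp, hb⟩
  · refine ⟨q, hq, ?_⟩
    generalize x p = a at *
    generalize x q = c at *
    fin_cases a <;> fin_cases b <;> fin_cases c <;> simp_all

-- Each of the `m` columns of height two contains the letter `b`. Applied to both letters, this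
-- confines the weight to the range from `m` to `n - m`.
open Finset in
theorem Tableau.Separates.le_card {x : Word n (Fin 2)} (hx : T.Separates x) (b : Fin 2) :
    m ≤ #{p | x p = b} := by
  choose p hp hb using fun j : Fin m => hx.exists_eq j.2 b
  have h := Finset.card_le_card_of_injOn (s := (univ : Finset (Fin m)))
    (t := {p | x p = b}) p (fun j _ => by simp [hb]) (fun i _ j _ hij => by
      apply Fin.ext
      rw [← hp i, ← hp j]
      exact congrArg T.col hij)
  simpa using h

open Finset in
theorem weight_eq_card (x : Word n (Fin 2)) : weight x = #{p | x p = 1} := by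
  rw [weight, Finset.card_filter]
  refine Finset.sum_congr rfl fun p _ => ?_
  generalize x p = a
  fin_cases a <;> simp

open Finset in
theorem weight_add_card (x : Word n (Fin 2)) : weight x + #{p | x p = 0} = n := by
  rw [weight, Finset.card_filter, ← Finset.sum_add_distrib]
  rw [Finset.sum_congr rfl (g := fun _ => 1)]
  · simp
  · intro p _
    generalize x p = a
    fin_cases a <;> simp

theorem Tableau.Separates.le_weight {x : Word n (Fin 2)} (hx : T.Separates x) :
    m ≤ weight x :=
  (hx.le_card 1).trans_eq (weight_eq_card x).symm

theorem Tableau.Separates.weight_le {x : Word n (Fin 2)} (hx : T.Separates x) :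
    weight x ≤ n - m := by
  have := hx.le_card 0
  have := weight_add_card x
  omega

/-- Two binary words with the same number of ones differ by a permutation. -/
theorem exists_perm_of_sum_eq {α : Type*} [Fintype α] (u v : α → Fin 2)
    (h : ∑ i, (u i : ℕ) = ∑ i, (v i : ℕ)) : ∃ σ : Equiv.Perm α, ∀ i, u (σ i) = v i := by
  classical
  have h1 : ∀ w : α → Fin 2, Fintype.card {i // w i = 1} = ∑ i, (w i : ℕ) := by
    intro w
    rw [Fintype.card_subtype, Finset.card_filter]
    refine Finset.sum_congr rfl fun p _ => ?_
    generalize w p = a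
    fin_cases a <;> simp
  have h0 : ∀ w : α → Fin 2, Fintype.card {i // w i = 0} + ∑ i, (w i : ℕ) = Fintype.card α := by
    intro w
    rw [Fintype.card_subtype, Finset.card_filter, ← Finset.sum_add_distrib]
    rw [Finset.sum_congr rfl (g := fun _ => 1)]
    · simp
    · intro p _
      generalize w p = a
      fin_cases a <;> simp
  have hc : ∀ c, Nonempty ({i // v i = c} ≃ {i // u i = c}) := by
    intro c
    rw [← Fintype.card_eq]
    have := h0 u
    have := h0 v
    fin_cases c
    · change Fintype.card {i // v i = 0} = Fintype.card {i // u i = 0}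
      omega
    · change Fintype.card {i // v i = 1} = Fintype.card {i // u i = 1}
      rw [h1, h1, h]
  exact ⟨Equiv.ofFiberEquiv fun c => (hc c).some, fun i => Equiv.ofFiberEquiv_map _ i⟩

variable (T)

theorem binaryRep_apply (s : Equiv.Perm (Fin n)) (f : BinaryFun n) (x : Word n (Fin 2)) :
    binaryRep n s f x = f fun p => x (s p) := by
  change f (fun p => x (s⁻¹⁻¹ p)) = _
  rw [inv_inv]

/-- The values at a polytabloid of the intertwining maps from the Specht module. -/
theorem Tableau.intertwiningMap_apply_comp_of_col
    (φ : (spechtRep n (twoRow n m hm)).IntertwiningMap (binaryRep n)) (s : Equiv.Perm (Fin n))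
    (hs : ∀ p, T.col (s p) = T.col p) (x : Word n (Fin 2)) :
    φ T.spechtVec (fun p => x (s p)) = ((Equiv.Perm.sign s : ℤ) : ℂ) * φ T.spechtVec x := by
  have h := congrFun (φ.isIntertwining _ _ s T.spechtVec) x
  have h2 : spechtRep n (twoRow n m hm) s T.spechtVec =
      ((Equiv.Perm.sign s : ℤ) : ℂ) • T.spechtVec :=
    Subtype.ext (T.functionRep_polytabloid_of_col s hs)
  rw [h2, map_smul, binaryRep_apply] at h
  exact h.symm

theorem Tableau.intertwiningMap_apply_comp_of_fixed
    (φ : (spechtRep n (twoRow n m hm)).IntertwiningMap (binaryRep n)) (g : Equiv.Perm (Fin n))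
    (hg : ∀ p, T.col p < m → g p = p) (x : Word n (Fin 2)) :
    φ T.spechtVec (fun p => x (g p)) = φ T.spechtVec x := by
  have h2 : spechtRep n (twoRow n m hm) g T.spechtVec = T.spechtVec := by
    refine Subtype.ext (T.functionRep_polytabloid_of_fixed g (fun p => ?_) fun p q h hpq =>
      hg p (T.col_lt_of_eq_of_ne h hpq))
    by_cases hp : T.col p < m
    · rw [hg p hp]
    · have hgp : ¬ T.col (g p) < m := by
        intro hlt
        have h1 := hg _ hlt
        rw [g.injective h1] at hlt
        exact hp hlt
      rw [T.row_eq_zero_of_le (not_lt.1 hp), T.row_eq_zero_of_le (not_lt.1 hgp)]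
  have h := congrFun (φ.isIntertwining _ _ g T.spechtVec) x
  rw [h2, binaryRep_apply] at h
  exact h.symm

/-- Swapping two equal letters in one column leaves the word unchanged but changes the sign of the
value, which must then be zero. -/
theorem Tableau.separates_of_ne_zero
    (φ : (spechtRep n (twoRow n m hm)).IntertwiningMap (binaryRep n)) {x : Word n (Fin 2)}
    (hx : φ T.spechtVec x ≠ 0) : T.Separates x := by
  intro p q hc hpq heq
  have h := T.intertwiningMap_apply_comp_of_col φ (Equiv.swap p q) (fun r => by
    by_cases h1 : r = p
    · rw [h1, Equiv.swap_apply_left, hc]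
    by_cases h2 : r = q
    · rw [h2, Equiv.swap_apply_right, hc]
    · rw [Equiv.swap_apply_of_ne_of_ne h1 h2]) x
  have hx' : (fun r => x (Equiv.swap p q r)) = x := by
    funext r
    by_cases h1 : r = p
    · rw [h1, Equiv.swap_apply_left, heq]
    by_cases h2 : r = q
    · rw [h2, Equiv.swap_apply_right, heq]
    · rw [Equiv.swap_apply_of_ne_of_ne h1 h2]
  rw [hx', Equiv.Perm.sign_swap hpq] at h
  apply hx
  simp only [Units.val_neg, Units.val_one, Int.cast_neg, Int.cast_one] at h
  linear_combination (1 / 2 : ℂ) * h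

/-- The value of an intertwining map at a polytabloid is determined, in each weight, by its value
at any one separated word. -/
theorem Tableau.intertwiningMap_apply_ne_zero
    (φ : (spechtRep n (twoRow n m hm)).IntertwiningMap (binaryRep n)) {x y : Word n (Fin 2)}
    (hx : φ T.spechtVec x ≠ 0) (hy : T.Separates y) (hxy : weight x = weight y) :
    φ T.spechtVec y ≠ 0 := by
  have hsx := T.separates_of_ne_zero φ hx
  -- A column-preserving rearrangement of `x` is made to agree with `y` on the columns of height
  -- two; it is injective because `y` separates columns, and it costs only a sign.
  have hex : ∀ p, ∃ q, T.col q = T.col p ∧ (T.col p < m → x q = y p) := by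
    intro p
    by_cases hp : T.col p < m
    · obtain ⟨q, hq, hq'⟩ := hsx.exists_eq hp (y p)
      exact ⟨q, hq, fun _ => hq'⟩
    · exact ⟨p, rfl, fun h => absurd h hp⟩
  choose s hs hs' using hex
  have hinj : Function.Injective s := by
    intro p q hpq
    have hc : T.col p = T.col q := by rw [← hs p, ← hs q, hpq]
    by_contra hne
    have hp := T.col_lt_of_eq_of_ne hc hne
    refine hy p q hc hne ?_
    rw [← hs' p hp, ← hs' q (hc ▸ hp), hpq]
  let σ : Equiv.Perm (Fin n) := Equiv.ofBijective s (Finite.injective_iff_bijective.1 hinj)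
  have h1 := T.intertwiningMap_apply_comp_of_col φ σ hs x
  set x' : Word n (Fin 2) := fun p => x (σ p) with hx'
  have hx'y : ∀ p, T.col p < m → x' p = y p := hs'
  have hw : ∑ p, (x' p : ℕ) = ∑ p, (y p : ℕ) := (Equiv.sum_comp σ fun p => (x p : ℕ)).trans hxy
  have hw' : ∑ p : {p // ¬ T.col p < m}, (x' p : ℕ) = ∑ p : {p // ¬ T.col p < m}, (y p : ℕ) := by
    rw [← Fintype.sum_subtype_add_sum_subtype (fun p => T.col p < m),
      ← Fintype.sum_subtype_add_sum_subtype (fun p => T.col p < m) (fun p => (y p : ℕ))] at hw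
    rw [Finset.sum_congr rfl fun (p : {p // T.col p < m}) _ => by rw [hx'y p.1 p.2]] at hw
    exact Nat.add_left_cancel hw
  -- The remaining positions carry equally many ones in both words, and permuting columns of height
  -- one does not change the value.
  obtain ⟨τ, hτ⟩ := exists_perm_of_sum_eq (fun p : {p // ¬ T.col p < m} => x' p) (fun p => y p) hw'
  have h2 := T.intertwiningMap_apply_comp_of_fixed φ (Equiv.Perm.ofSubtype τ)
    (fun p hp => Equiv.Perm.ofSubtype_apply_of_not_mem τ (by simpa using hp)) x'
  have h3 : (fun p => x' (Equiv.Perm.ofSubtype τ p)) = y := by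
    funext p
    by_cases hp : T.col p < m
    · rw [Equiv.Perm.ofSubtype_apply_of_not_mem τ (by simpa using hp), hx'y p hp]
    · rw [Equiv.Perm.ofSubtype_apply_of_mem τ hp]
      exact hτ ⟨p, hp⟩
  rw [h3, h1] at h2
  rw [h2]
  exact mul_ne_zero (by exact_mod_cast (Equiv.Perm.sign σ).ne_zero) hx

end TwoRow

/-! ### The highest weight vector and the basis obtained by lowering it. -/

section Highest

variable {n m : ℕ} {hm : 2 * m ≤ n}

/-- A binary word as a word over the natural numbers. -/
def wordVal (x : Word n (Fin 2)) : Word n ℕ := fun i => x i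

/-- The restriction to binary words of the functions in a Specht module. -/
def spechtRestrict (n : ℕ) (μ : YoungDiagram) :
    (spechtRep n μ).IntertwiningMap (binaryRep n) where
  toFun v x := v.1 (wordVal x)
  map_add' _ _ := rfl
  map_smul' _ _ := rfl
  isIntertwining' _ := rfl

theorem exists_wordVal_eq (z : Word n ℕ) (hz : ∀ p, z p < 2) : ∃ x, wordVal x = z :=
  ⟨fun p => ⟨z p, hz p⟩, rfl⟩

theorem Tableau.sum_row (T : Tableau n (twoRow n m hm)) : ∑ p, T.row p = m := by
  have h : ∑ p, T.row p = ∑ c ∈ (twoRow n m hm).cells, c.1 :=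
    (Equiv.sum_comp T fun c => c.1.1).trans (Finset.sum_coe_sort _ _)
  have hc : (twoRow n m hm).cells.filter (fun c => c.1 ≠ 0) =
      ({1} : Finset ℕ) ×ˢ Finset.range m := by
    ext c
    rw [Finset.mem_filter, mem_twoRow_iff, Finset.mem_product, Finset.mem_singleton,
      Finset.mem_range]
    omega
  rw [h, ← Finset.sum_filter_ne_zero, hc, Finset.sum_product]
  simp

/-- An element of a two-row Specht module is supported on the words over `0, 1` with `m` ones. -/
theorem specht_support (v : Specht n (twoRow n m hm)) (z : Word n ℕ) (hz : v.1 z ≠ 0) :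
    (∀ p, z p < 2) ∧ ∑ p, z p = m := by
  obtain ⟨T⟩ := nonempty_tableau_twoRow (n := n) (m := m) (hm := hm)
  let U : Submodule ℂ (Specht n (twoRow n m hm)) :=
    { carrier := {v | ∀ z, ¬ ((∀ p, z p < 2) ∧ ∑ p, z p = m) → v.1 z = 0}
      add_mem' := fun {a b} ha hb z hz => by
        change a.1 z + b.1 z = 0
        rw [ha z hz, hb z hz, add_zero]
      zero_mem' := fun z _ => rfl
      smul_mem' := fun c a ha z hz => by
        change c * a.1 z = 0
        rw [ha z hz, mul_zero] }
  have hU : U = ⊤ := T.specht_induction U fun g z hz => by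
    by_contra hne
    apply hz
    change T.polytabloid (g⁻¹ • z) ≠ 0 at hne
    obtain ⟨s, hs⟩ := T.exists_smul_of_polytabloid_ne_zero hne
    rw [inv_smul_eq_iff, smul_smul] at hs
    rw [hs]
    refine ⟨fun p => T.row_lt_two _, ?_⟩
    exact (Equiv.sum_comp (g * s)⁻¹ fun p => T.row p).trans T.sum_row
  have hv : v ∈ (⊤ : Submodule ℂ (Specht n (twoRow n m hm))) := trivial
  rw [← hU] at hv
  by_contra hne
  exact hz (hv z hne)

theorem spechtRestrict_injective :
    Function.Injective (spechtRestrict n (twoRow n m hm)) := by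
  rw [← Representation.IntertwiningMap.coe_toLinearMap, ← LinearMap.ker_eq_bot,
    LinearMap.ker_eq_bot']
  intro v hv
  apply Subtype.ext
  funext z
  by_contra hne
  obtain ⟨x, rfl⟩ := exists_wordVal_eq z (specht_support v z hne).1
  exact hne (congrFun hv x)

theorem spechtRestrict_support (v : Specht n (twoRow n m hm)) (x : Word n (Fin 2))
    (hx : (weight x : ℤ) ≠ m) : spechtRestrict n (twoRow n m hm) v x = 0 := by
  by_contra hne
  exact hx (congrArg Nat.cast (specht_support v _ hne).2)

theorem Tableau.spechtVec_ne_zero (T : Tableau n (twoRow n m hm)) : T.spechtVec ≠ 0 := by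
  intro h
  have h1 := congrFun (congrArg Subtype.val h) T.tabloid
  change T.polytabloid T.tabloid = 0 at h1
  rw [T.polytabloid_tabloid] at h1
  exact one_ne_zero h1

theorem lie_H_spechtRestrict :
    ⁅sl2H, spechtRestrict n (twoRow n m hm)⁆ =
      ((n - 2 * m : ℕ) : ℂ) • spechtRestrict n (twoRow n m hm) := by
  refine DFunLike.ext _ _ fun v => ?_
  have h := (lie_sl2H_eq_smul_iff (m : ℤ) _).2 (spechtRestrict_support v)
  rw [lie_intertwiningMap_apply, h]
  push_cast [Nat.cast_sub hm]
  rfl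

/-- Raising in `sl₂` lowers the weight of words to `m - 1`, while the image of a polytabloid is
supported on separated words, which have weight at least `m`. -/
theorem lie_E_spechtRestrict : ⁅sl2E, spechtRestrict n (twoRow n m hm)⁆ = 0 := by
  obtain ⟨T⟩ := nonempty_tableau_twoRow (n := n) (m := m) (hm := hm)
  set ψ := ⁅sl2E, spechtRestrict n (twoRow n m hm)⁆ with hψ
  -- The weight `m - 1` is taken in the integers, which covers `m = 0`.
  have h : ⁅sl2H, ψ⁆ = ((n : ℂ) - 2 * ((m - 1 : ℤ) : ℂ)) • ψ := by
    rw [hψ, leibniz_lie, isSl2Triple_sl2.lie_h_e_smul ℂ, lie_H_spechtRestrict, smul_lie]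
    have h1 : ⁅sl2E, ((n - 2 * m : ℕ) : ℂ) • spechtRestrict n (twoRow n m hm)⁆ =
        ((n - 2 * m : ℕ) : ℂ) • ⁅sl2E, spechtRestrict n (twoRow n m hm)⁆ :=
      lie_smul (R := ℂ) ((n - 2 * m : ℕ) : ℂ) sl2E (spechtRestrict n (twoRow n m hm))
    rw [h1, ← add_smul]
    congr 1
    push_cast [Nat.cast_sub hm]
    ring
  apply T.intertwiningMap_ext
  funext x
  by_contra hne
  have h2 := (lie_sl2H_eq_smul_iff (m - 1 : ℤ) (ψ T.spechtVec)).1 (by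
    rw [← lie_intertwiningMap_apply, h]
    rfl)
  have h3 := (T.separates_of_ne_zero ψ hne).le_weight
  exact hne (h2 x (by omega))

/-- The basis of the multiplicity space of a Specht module, obtained by lowering the
restriction map. -/
def lowered (n m : ℕ) (hm : 2 * m ≤ n) (i : ℕ) :
    (spechtRep n (twoRow n m hm)).IntertwiningMap (binaryRep n) :=
  ((LieModule.toEnd ℂ sl2 _ sl2F) ^ i) (spechtRestrict n (twoRow n m hm))

theorem isPrimitive_spechtRestrict : isSl2Triple_sl2.HasPrimitiveVectorWith
    (spechtRestrict n (twoRow n m hm)) ((n - 2 * m : ℕ) : ℂ) where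
  ne_zero h := by
    obtain ⟨T⟩ := nonempty_tableau_twoRow (n := n) (m := m) (hm := hm)
    refine T.spechtVec_ne_zero (spechtRestrict_injective ?_)
    rw [h, map_zero]
    rfl
  lie_h := lie_H_spechtRestrict
  lie_e := lie_E_spechtRestrict

theorem lie_E_lowered_succ (i : ℕ) : ⁅sl2E, lowered n m hm (i + 1)⁆ =
    ((i + 1 : ℂ) * ((n - 2 * m : ℕ) - i)) • lowered n m hm i :=
  isPrimitive_spechtRestrict.lie_e_pow_succ_toEnd_f i

/-- Every nonzero `v` restricts to a highest weight vector of weight `n - 2m`, so its first `n - 2m`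
lowerings are nonzero. Injectivity of the lowered maps thus needs no Schur lemma. -/
theorem lowered_apply_ne_zero {i : ℕ} (hi : i ≤ n - 2 * m) {v : Specht n (twoRow n m hm)}
    (hv : v ≠ 0) : lowered n m hm i v ≠ 0 := by
  have P : isSl2Triple_sl2.HasPrimitiveVectorWith
      (spechtRestrict n (twoRow n m hm) v) ((n - 2 * m : ℕ) : ℂ) :=
    { ne_zero := fun h => hv (spechtRestrict_injective (by rw [h, map_zero]))
      lie_h := by rw [← lie_intertwiningMap_apply, lie_H_spechtRestrict]; rfl
      lie_e := by rw [← lie_intertwiningMap_apply, lie_E_spechtRestrict]; rfl }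
  rw [lowered, toEnd_pow_intertwiningMap_apply]
  exact P.pow_toEnd_f_ne_zero_of_eq_nat rfl hi

theorem lowered_injective {i : ℕ} (hi : i ≤ n - 2 * m) :
    Function.Injective (lowered n m hm i) := by
  rw [← Representation.IntertwiningMap.coe_toLinearMap, ← LinearMap.ker_eq_bot,
    LinearMap.ker_eq_bot']
  intro v hv
  by_contra hne
  exact lowered_apply_ne_zero hi hne hv

theorem lowered_support (i : ℕ) (v : Specht n (twoRow n m hm)) (x : Word n (Fin 2))
    (hx : weight x ≠ m + i) : lowered n m hm i v x = 0 := by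
  have h := isPrimitive_spechtRestrict (hm := hm).lie_h_pow_toEnd_f i
  refine (lie_sl2H_eq_smul_iff (m + i : ℤ) (lowered n m hm i v)).1 ?_ x (by omega)
  rw [← lie_intertwiningMap_apply]
  refine (congrArg (fun φ => φ v) h).trans ?_
  change (((n - 2 * m : ℕ) : ℂ) - 2 * i) • (lowered n m hm i v) = _
  congr 1
  push_cast [Nat.cast_sub hm]
  ring

theorem Tableau.exists_lowered_ne_zero (T : Tableau n (twoRow n m hm)) {i : ℕ}
    (hi : i ≤ n - 2 * m) : ∃ x, lowered n m hm i T.spechtVec x ≠ 0 :=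
  Function.ne_iff.1 (lowered_apply_ne_zero hi T.spechtVec_ne_zero)

theorem weight_of_lowered_ne_zero {i : ℕ} {v : Specht n (twoRow n m hm)} {x : Word n (Fin 2)}
    (hx : lowered n m hm i v x ≠ 0) : weight x = m + i := by
  by_contra h
  exact hx (lowered_support i v x h)

theorem sum_lowered_apply (c : Fin (n - 2 * m + 1) → ℂ) (v : Specht n (twoRow n m hm))
    (x : Word n (Fin 2)) (i : Fin (n - 2 * m + 1)) (hx : weight x = m + i) :
    (∑ j, c j • lowered n m hm j : (spechtRep n (twoRow n m hm)).IntertwiningMap (binaryRep n)) v x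
      = c i * lowered n m hm i v x := by
  rw [Representation.IntertwiningMap.sum_apply, Finset.sum_apply, Finset.sum_eq_single i]
  · rfl
  · intro j _ hj
    change c j * lowered n m hm j v x = 0
    rw [lowered_support, mul_zero]
    intro h
    exact hj (Fin.ext (by omega))
  · simp

theorem linearIndependent_lowered :
    LinearIndependent ℂ fun i : Fin (n - 2 * m + 1) => lowered n m hm i := by
  obtain ⟨T⟩ := nonempty_tableau_twoRow (n := n) (m := m) (hm := hm)
  rw [Fintype.linearIndependent_iff]
  intro c hc i
  obtain ⟨x, hx⟩ := T.exists_lowered_ne_zero (Nat.lt_succ_iff.1 i.2)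
  have h := sum_lowered_apply c T.spechtVec x i (weight_of_lowered_ne_zero hx)
  rw [hc] at h
  exact (mul_eq_zero.1 h.symm).resolve_right hx

/-- Subtracting a combination matched to `φ` at one separated word of each weight leaves a map
vanishing at those words. A nonzero value at another word of the same weight would force a nonzero
value there. -/
theorem span_lowered :
    ⊤ ≤ Submodule.span ℂ (Set.range fun i : Fin (n - 2 * m + 1) => lowered n m hm i) := by
  obtain ⟨T⟩ := nonempty_tableau_twoRow (n := n) (m := m) (hm := hm)
  rintro φ -
  choose y hy using fun i : Fin (n - 2 * m + 1) =>
    T.exists_lowered_ne_zero (Nat.lt_succ_iff.1 i.2)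
  rw [Submodule.mem_span_range_iff_exists_fun]
  set c : Fin (n - 2 * m + 1) → ℂ := fun i =>
    φ T.spechtVec (y i) / lowered n m hm i T.spechtVec (y i) with hc
  refine ⟨c, ?_⟩
  set ψ := φ - ∑ j, c j • lowered n m hm j with hψ
  have key : ψ T.spechtVec = 0 := by
    funext x
    by_contra hne
    have hs := T.separates_of_ne_zero ψ hne
    have h1 := hs.le_weight
    have h2 := hs.weight_le
    let i : Fin (n - 2 * m + 1) := ⟨weight x - m, by omega⟩
    have hw := weight_of_lowered_ne_zero (hy i)
    have hi : (i : ℕ) = weight x - m := rfl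
    refine T.intertwiningMap_apply_ne_zero ψ hne (T.separates_of_ne_zero _ (hy i)) (by omega) ?_
    rw [hψ, Representation.IntertwiningMap.coe_sub, Pi.sub_apply, Pi.sub_apply,
      sum_lowered_apply c _ _ i hw, hc]
    simp only
    rw [div_mul_cancel₀ _ (hy i), sub_self]
  have : ψ = 0 := T.intertwiningMap_ext (by rw [key]; rfl)
  exact (sub_eq_zero.1 this).symm

/-- The basis of lowered restriction maps. -/
noncomputable def loweredBasis (n m : ℕ) (hm : 2 * m ≤ n) :
    Module.Basis (Fin (n - 2 * m + 1)) ℂ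
      ((spechtRep n (twoRow n m hm)).IntertwiningMap (binaryRep n)) :=
  Module.Basis.mk linearIndependent_lowered span_lowered

theorem loweredBasis_apply (i : Fin (n - 2 * m + 1)) :
    loweredBasis n m hm i = lowered n m hm i :=
  Module.Basis.mk_apply _ _ i

theorem toEnd_E_pow_lowered (i : ℕ) (hi : i ≤ n - 2 * m) : ∃ c : ℂ, c ≠ 0 ∧
    ((LieModule.toEnd ℂ sl2 _ sl2E) ^ i) (lowered n m hm i) = c • lowered n m hm 0 := by
  induction i with
  | zero => exact ⟨1, one_ne_zero, (one_smul _ _).symm⟩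
  | succ i ih =>
    obtain ⟨c, hc, h⟩ := ih (by omega)
    refine ⟨(i + 1 : ℂ) * ((n - 2 * m : ℕ) - i) * c, mul_ne_zero (mul_ne_zero ?_ ?_) hc, ?_⟩
    · exact_mod_cast i.succ_ne_zero
    · rw [sub_ne_zero]
      exact_mod_cast (by omega : n - 2 * m ≠ i)
    · rw [pow_succ, Module.End.mul_apply, LieModule.toEnd_apply_apply, lie_E_lowered_succ,
        map_smul, h, smul_smul]

theorem toEnd_E_pow_lowered_of_lt {i j : ℕ} (hij : j < i) :
    ((LieModule.toEnd ℂ sl2 _ sl2E) ^ i) (lowered n m hm j) = 0 := by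
  induction i generalizing j with
  | zero => omega
  | succ i ih =>
    rw [pow_succ, Module.End.mul_apply, LieModule.toEnd_apply_apply]
    rcases j with _ | j
    · have : ⁅sl2E, lowered n m hm 0⁆ = 0 := lie_E_spechtRestrict
      rw [this, map_zero]
    · rw [lie_E_lowered_succ, map_smul, ih (by omega), smul_zero]

/-- If `i` is the largest index in the expansion of a nonzero element, `E^i` sends it to a nonzero
multiple of the highest weight vector, from which lowering recovers the whole basis. -/
theorem isIrreducible_multiplicitySpace : LieModule.IsIrreducible ℂ sl2
    ((spechtRep n (twoRow n m hm)).IntertwiningMap (binaryRep n)) := by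
  have : Nontrivial ((spechtRep n (twoRow n m hm)).IntertwiningMap (binaryRep n)) :=
    ⟨_, _, isPrimitive_spechtRestrict.ne_zero⟩
  refine LieModule.IsIrreducible.mk fun N hN => ?_
  rw [Ne, ← LieSubmodule.toSubmodule_eq_bot] at hN
  obtain ⟨φ, hφN, hφ⟩ := Submodule.exists_mem_ne_zero_of_ne_bot hN
  have hpow : ∀ (A : sl2) (k : ℕ) (ψ), ψ ∈ N → ((LieModule.toEnd ℂ sl2 _ A) ^ k) ψ ∈ N := by
    intro A k
    induction k with
    | zero => exact fun ψ h => h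
    | succ k ih =>
      intro ψ h
      rw [pow_succ', Module.End.mul_apply]
      exact N.lie_mem (ih ψ h)
  have h0 : lowered n m hm 0 ∈ N := by
    let b := loweredBasis n m hm
    have hne : (Finset.univ.filter fun i => b.repr φ i ≠ 0).Nonempty := by
      by_contra hemp
      rw [Finset.not_nonempty_iff_eq_empty, Finset.filter_eq_empty_iff] at hemp
      refine hφ (b.ext_elem fun i => ?_)
      simpa using hemp (Finset.mem_univ i)
    obtain ⟨i, hi, hmax⟩ := Finset.exists_max_image _ id hne
    simp only [Finset.mem_filter, Finset.mem_univ, true_and, id] at hi hmax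
    obtain ⟨c, hc, hci⟩ := toEnd_E_pow_lowered (hm := hm) (i : ℕ) (Nat.lt_succ_iff.1 i.2)
    have h1 : ((LieModule.toEnd ℂ sl2 _ sl2E) ^ (i : ℕ)) φ =
        (b.repr φ i * c) • lowered n m hm 0 := by
      conv_lhs => rw [← b.sum_repr φ]
      rw [map_sum, Finset.sum_eq_single i]
      · rw [map_smul, loweredBasis_apply, hci, smul_smul]
      · intro j _ hj
        rw [map_smul, loweredBasis_apply]
        by_cases hz : b.repr φ j = 0
        · rw [hz, zero_smul]
        · rw [toEnd_E_pow_lowered_of_lt (lt_of_le_of_ne (hmax j hz) fun h => hj (Fin.ext h)),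
            smul_zero]
      · simp
    have h2 := hpow sl2E i φ hφN
    rw [h1] at h2
    exact (N.toSubmodule.smul_mem_iff (mul_ne_zero hi hc)).1 h2
  rw [← LieSubmodule.toSubmodule_eq_top, eq_top_iff]
  refine span_lowered.trans (Submodule.span_le.2 ?_)
  rintro _ ⟨i, rfl⟩
  exact hpow sl2F i _ h0

end Highest

/-! ### Isotypic components and intertwining maps. -/

section Isotypic

variable {G V W : Type*} [Group G] [AddCommGroup V] [Module ℂ V] [AddCommGroup W] [Module ℂ W]
  {ρ : Representation ℂ G V} {σ : Representation ℂ G W}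

theorem apply_mem_isotypicPart (φ : σ.IntertwiningMap ρ) (hφ : Function.Injective φ) (w : W) :
    φ w ∈ isotypicPart ρ σ := by
  let Φ := Representation.IntertwiningMap.equivLinearMapAsModule σ ρ φ
  have hΦ : Function.Injective Φ := hφ
  refine ⟨Φ w, ?_, rfl⟩
  have hle : LinearMap.range Φ ≤
      isotypicComponent (MonoidAlgebra ℂ G) ρ.asModule σ.asModule :=
    le_sSup ⟨(LinearEquiv.ofInjective Φ hΦ).symm⟩
  exact hle (LinearMap.mem_range_self Φ w)

/-- Each summand isomorphic to `σ` is the image of an intertwining map, so checking such images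
suffices. This gives both surjectivity of evaluation and invariance of the component under `K_n`. -/
theorem isotypicPart_le {U : Submodule ℂ V} (hU : ∀ (φ : σ.IntertwiningMap ρ) w, φ w ∈ U) :
    isotypicPart ρ σ ≤ U := by
  rintro _ ⟨v, hv, rfl⟩
  change v ∈ isotypicComponent (MonoidAlgebra ℂ G) ρ.asModule σ.asModule at hv
  rw [isotypicComponent, sSup_eq_iSup'] at hv
  refine Submodule.iSup_induction _ (motive := fun v => ρ.asModuleEquiv v ∈ U) hv ?_ ?_ ?_
  · rintro ⟨M, ⟨e⟩⟩ x hx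
    let Φ : σ.asModule →ₗ[MonoidAlgebra ℂ G] ρ.asModule := M.subtype ∘ₗ e.symm.toLinearMap
    have h := hU ((Representation.IntertwiningMap.equivLinearMapAsModule σ ρ).symm Φ)
      (e ⟨x, hx⟩)
    have h2 : (Representation.IntertwiningMap.equivLinearMapAsModule σ ρ).symm Φ (e ⟨x, hx⟩) =
        x := by
      change ((e.symm (e ⟨x, hx⟩) : M) : ρ.asModule) = x
      rw [e.symm_apply_apply]
    rwa [h2] at h
  · rw [map_zero]; exact U.zero_mem
  · intro x y hx hy
    rw [map_add]; exact U.add_mem hx hy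

end Isotypic

/-! ### The evaluation isomorphism onto the isotypic component. -/

section Evaluation

variable {n m : ℕ} {hm : 2 * m ≤ n}

instance nontrivial_specht : Nontrivial (Specht n (twoRow n m hm)) := by
  obtain ⟨T⟩ := nonempty_tableau_twoRow (n := n) (m := m) (hm := hm)
  exact ⟨_, _, T.spechtVec_ne_zero⟩

instance finite_specht : Module.Finite ℂ (Specht n (twoRow n m hm)) :=
  Module.Finite.of_injective (spechtRestrict n (twoRow n m hm)).toLinearMap
    spechtRestrict_injective

/-- An arbitrary intertwining map need not be known to be injective: it is a combination of lowered
maps, which are. -/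
theorem apply_mem_spechtIsotypic
    (φ : (spechtRep n (twoRow n m hm)).IntertwiningMap (binaryRep n))
    (v : Specht n (twoRow n m hm)) : φ v ∈ spechtIsotypic n (twoRow n m hm) := by
  rw [← (loweredBasis n m hm).sum_repr φ, Representation.IntertwiningMap.sum_apply]
  refine Submodule.sum_mem _ fun i _ => ?_
  rw [loweredBasis_apply]
  exact Submodule.smul_mem _ _ (apply_mem_isotypicPart (lowered n m hm i)
    (lowered_injective (Nat.lt_succ_iff.1 i.2)) v)

/-- Evaluation of the intertwining maps from the Specht module. -/
noncomputable def evalMap (n m : ℕ) (hm : 2 * m ≤ n) :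
    Specht n (twoRow n m hm) ⊗[ℂ] (spechtRep n (twoRow n m hm)).IntertwiningMap (binaryRep n) →ₗ[ℂ]
      spechtIsotypic n (twoRow n m hm) :=
  TensorProduct.lift (LinearMap.mk₂ ℂ (fun v φ => ⟨φ v, apply_mem_spechtIsotypic φ v⟩)
    (fun v w φ => Subtype.ext (map_add φ v w)) (fun c v φ => Subtype.ext (map_smul φ c v))
    (fun _ _ _ => rfl) (fun _ _ _ => rfl))

theorem evalMap_tmul (v : Specht n (twoRow n m hm))
    (φ : (spechtRep n (twoRow n m hm)).IntertwiningMap (binaryRep n)) :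
    (evalMap n m hm (v ⊗ₜ φ) : BinaryFun n) = φ v := rfl

theorem evalMap_surjective : Function.Surjective (evalMap n m hm) := by
  have h := isotypicPart_le
    (U := (LinearMap.range (evalMap n m hm)).map (spechtIsotypic n (twoRow n m hm)).subtype)
    (ρ := binaryRep n) (σ := spechtRep n (twoRow n m hm))
    fun φ v => ⟨_, ⟨v ⊗ₜ φ, rfl⟩, rfl⟩
  intro f
  obtain ⟨_, ⟨t, rfl⟩, ht⟩ := h f.2
  exact ⟨t, Subtype.ext ht⟩

/-- The contributions of different basis elements live in different weights, so they vanish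
separately, and each lowered map is injective. -/
theorem evalMap_injective : Function.Injective (evalMap n m hm) := by
  refine (injective_iff_map_eq_zero _).2 fun t ht => ?_
  obtain ⟨b, rfl⟩ := TensorProduct.eq_repr_basis_right (loweredBasis n m hm) t
  rw [Finsupp.sum_fintype b (fun i v => v ⊗ₜ[ℂ] loweredBasis n m hm i)
    fun i => TensorProduct.zero_tmul _ _] at ht ⊢
  rw [map_sum] at ht
  have h : ∑ i : Fin (n - 2 * m + 1), lowered n m hm i (b i) = 0 := by
    rw [← Submodule.coe_eq_zero, Submodule.coe_sum] at ht
    simpa only [evalMap_tmul, loweredBasis_apply] using ht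
  refine Finset.sum_eq_zero fun i _ => ?_
  suffices hb : b i = 0 by rw [hb, TensorProduct.zero_tmul]
  by_contra hb
  refine lowered_apply_ne_zero (Nat.lt_succ_iff.1 i.2) hb ?_
  funext x
  by_cases hx : weight x = m + i
  · have hsum := congrFun h x
    rwa [Finset.sum_apply, Finset.sum_eq_single i] at hsum
    · intro j _ hj
      exact lowered_support _ _ _ fun hj' => hj (Fin.ext (by omega))
    · simp
  · exact lowered_support _ _ _ hx

/-- The isotypic component as a tensor product with the multiplicity space. -/
noncomputable def evalEquiv (n m : ℕ) (hm : 2 * m ≤ n) :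
    Specht n (twoRow n m hm) ⊗[ℂ] (spechtRep n (twoRow n m hm)).IntertwiningMap (binaryRep n) ≃ₗ[ℂ]
      spechtIsotypic n (twoRow n m hm) :=
  LinearEquiv.ofBijective (evalMap n m hm) ⟨evalMap_injective, evalMap_surjective⟩

theorem evalEquiv_tmul (v : Specht n (twoRow n m hm))
    (φ : (spechtRep n (twoRow n m hm)).IntertwiningMap (binaryRep n)) :
    (evalEquiv n m hm (v ⊗ₜ φ) : BinaryFun n) = φ v := rfl

theorem isPermEquivariant_evalEquiv : IsPermEquivariant (evalEquiv n m hm) := fun g s φ => by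
  rw [evalEquiv_tmul, evalEquiv_tmul, φ.isIntertwining]

theorem isSl2Equivariant_evalEquiv : IsSl2Equivariant (evalEquiv n m hm) := fun _ _ _ => rfl

end Evaluation

/-! ### The Burnside operator on the multiplicity space. -/

section Burnside

variable {n m : ℕ} {hm : 2 * m ≤ n}

theorem map_tensorPow_smul_smul (N : Matrix (Fin 2) (Fin 2) (MvPolynomial (Fin 2) ℂ))
    (s : Equiv.Perm (Fin n)) (x y : Word n (Fin 2)) :
    (tensorPow n N).map arcsineExp (s • x) (s • y) = (tensorPow n N).map arcsineExp x y :=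
  congrArg arcsineExp (tensorPow_smul_smul N s x y)

theorem binaryBurnside_binaryRep (s : Equiv.Perm (Fin n)) (f : BinaryFun n) :
    binaryBurnside n (binaryRep n s f) = binaryRep n s (binaryBurnside n f) := by
  rw [← burnsideMatrix_mulVec, ← burnsideMatrix_mulVec]
  exact mulVec_binaryRep (map_tensorPow_smul_smul letterMatrix) s f

/-- The Burnside operator on the multiplicity space of a Specht module. -/
noncomputable def multiplicityBurnside (n m : ℕ) (hm : 2 * m ≤ n) :
    Module.End ℂ ((spechtRep n (twoRow n m hm)).IntertwiningMap (binaryRep n)) :=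
  compCommuting _ (binaryBurnside n) binaryBurnside_binaryRep

theorem binaryBurnside_mem_spechtIsotypic (f : BinaryFun n)
    (hf : f ∈ spechtIsotypic n (twoRow n m hm)) :
    binaryBurnside n f ∈ spechtIsotypic n (twoRow n m hm) :=
  isotypicPart_le (U := (spechtIsotypic n (twoRow n m hm)).comap (binaryBurnside n))
    (fun φ v => apply_mem_spechtIsotypic (multiplicityBurnside n m hm φ) v) hf

/-- The operator on the multiplicity space given by the triangular form of the Burnside matrix. -/
noncomputable def multiplicityTriangular (n m : ℕ) (hm : 2 * m ≤ n) :
    Module.End ℂ ((spechtRep n (twoRow n m hm)).IntertwiningMap (binaryRep n)) :=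
  compCommuting _ (burnsideTriangular n).mulVecLin
    (mulVec_binaryRep (map_tensorPow_smul_smul letterTriangular))

/-- The change of basis on the multiplicity space that triangularizes the Burnside operator. -/
noncomputable def multiplicityChange (n m : ℕ) (hm : 2 * m ≤ n) :
    (spechtRep n (twoRow n m hm)).IntertwiningMap (binaryRep n) ≃ₗ[ℂ]
      (spechtRep n (twoRow n m hm)).IntertwiningMap (binaryRep n) :=
  LinearEquiv.ofLinearMap
    (compCommuting _ (tensorPow n hadamard).mulVecLin
      (mulVec_binaryRep (tensorPow_smul_smul hadamard)))
    (compCommuting _ (tensorPow n ((1 / 2 : ℂ) • hadamard)).mulVecLin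
      (mulVec_binaryRep (tensorPow_smul_smul ((1 / 2 : ℂ) • hadamard))))
    (LinearMap.ext fun φ => Representation.IntertwiningMap.ext_apply fun v => by
      change (tensorPow n hadamard).mulVec
        ((tensorPow n ((1 / 2 : ℂ) • hadamard)).mulVec (φ v)) = φ v
      rw [Matrix.mulVec_mulVec, ← tensorPow_mul, hadamard_mul_self, tensorPow_one,
        Matrix.one_mulVec])
    (LinearMap.ext fun φ => Representation.IntertwiningMap.ext_apply fun v => by
      change (tensorPow n ((1 / 2 : ℂ) • hadamard)).mulVec
        ((tensorPow n hadamard).mulVec (φ v)) = φ v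
      rw [Matrix.mulVec_mulVec, ← tensorPow_mul, Matrix.smul_mul, ← Matrix.mul_smul,
        hadamard_mul_self, tensorPow_one, Matrix.one_mulVec])

theorem multiplicityBurnside_eq_conj :
    multiplicityBurnside n m hm =
      (multiplicityChange n m hm).conj (multiplicityTriangular n m hm) := by
  refine LinearMap.ext fun φ => ?_
  obtain ⟨ψ, rfl⟩ := (multiplicityChange n m hm).surjective φ
  rw [LinearEquiv.conj_apply_apply, LinearEquiv.symm_apply_apply]
  refine Representation.IntertwiningMap.ext_apply fun v => ?_
  change binaryBurnside n ((tensorPow n hadamard).mulVec (ψ v)) =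
    (tensorPow n hadamard).mulVec ((burnsideTriangular n).mulVec (ψ v))
  rw [← burnsideMatrix_mulVec, Matrix.mulVec_mulVec, Matrix.mulVec_mulVec,
    burnsideMatrix_mul_hadamard]

theorem Tableau.apply_eq_repr_mul (T : Tableau n (twoRow n m hm))
    (φ : (spechtRep n (twoRow n m hm)).IntertwiningMap (binaryRep n))
    (j : Fin (n - 2 * m + 1)) (x : Word n (Fin 2)) (hx : weight x = m + j) :
    φ T.spechtVec x = (loweredBasis n m hm).repr φ j * lowered n m hm j T.spechtVec x := by
  conv_lhs => rw [← (loweredBasis n m hm).sum_repr φ]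
  simp only [loweredBasis_apply]
  exact sum_lowered_apply _ _ _ _ hx

/-- The coordinate `j` is read off at one word of weight `m + j` where the lowered map does not
vanish; there the triangular matrix acts by a scalar. -/
theorem repr_multiplicityTriangular {i j : Fin (n - 2 * m + 1)} (hij : i ≤ j) :
    (loweredBasis n m hm).repr (multiplicityTriangular n m hm (lowered n m hm i)) j =
      if i = j then differenceMoment (m + i) else 0 := by
  obtain ⟨T⟩ := nonempty_tableau_twoRow (n := n) (m := m) (hm := hm)
  obtain ⟨x, hx⟩ := T.exists_lowered_ne_zero (Nat.lt_succ_iff.1 j.2)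
  have hw := weight_of_lowered_ne_zero hx
  have h := T.apply_eq_repr_mul (multiplicityTriangular n m hm (lowered n m hm i)) j x hw
  have hle : m + (i : ℕ) ≤ weight x := by
    rw [hw]
    exact Nat.add_le_add_left hij m
  have h2 : multiplicityTriangular n m hm (lowered n m hm i) T.spechtVec x =
      differenceMoment (m + i) * lowered n m hm i T.spechtVec x :=
    burnsideTriangular_mulVec_of_weight (lowered_support i T.spechtVec) x hle
  rw [h2] at h
  refine mul_right_cancel₀ hx (h.symm.trans ?_)
  split_ifs with hij'
  · rw [hij']
  · rw [lowered_support i, mul_zero, zero_mul]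
    intro h3
    exact hij' (Fin.ext (by omega))

open Polynomial in
theorem charpoly_multiplicityBurnside : (multiplicityBurnside n m hm).charpoly =
    ∏ i : Fin (n - 2 * m + 1), (X - C (differenceMoment (m + i))) := by
  rw [multiplicityBurnside_eq_conj, LinearEquiv.charpoly_conj,
    ← LinearMap.charpoly_toMatrix _ (loweredBasis n m hm), Matrix.charpoly_of_isUpperTriangular]
  · refine Finset.prod_congr rfl fun i _ => ?_
    rw [LinearMap.toMatrix_apply, loweredBasis_apply, repr_multiplicityTriangular le_rfl,
      if_pos rfl]
  · intro i j hij
    change j < i at hij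
    rw [LinearMap.toMatrix_apply, loweredBasis_apply, repr_multiplicityTriangular hij.le,
      if_neg hij.ne]

end Burnside

/-! ### Eigenvalue multiplicities, and their behaviour under tensoring. -/

section Multiplicity

theorem differenceMoment_eq_iff {l : ℕ} {c : ℂ} (hc : c ≠ 0) :
    c = differenceMoment l ↔ ∃ k, l = 2 * k ∧ c = burnsideEigenvalue k := by
  constructor
  · intro h
    obtain ⟨k, hk | hk⟩ := Nat.even_or_odd' l
    · exact ⟨k, hk, by rw [h, hk, differenceMoment_even]⟩
    · rw [hk, differenceMoment_odd] at h
      exact absurd h hc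
  · rintro ⟨k, rfl, h⟩
    rw [h, differenceMoment_even]

open Polynomial in
/-- The eigenvalues of an operator whose characteristic polynomial has the roots
`E[(θ - φ) ^ l]` for `m ≤ l ≤ n - m`. -/
theorem hasEigenvalue_iff_of_charpoly {n m : ℕ} (hm : 2 * m ≤ n) {V : Type*} [AddCommGroup V]
    [Module ℂ V] [Module.Finite ℂ V] {T : Module.End ℂ V}
    (hT : T.charpoly = ∏ i : Fin (n - 2 * m + 1), (X - C (differenceMoment (m + i))))
    {c : ℂ} (hc : c ≠ 0) : T.HasEigenvalue c ↔
      ∃ k : ℕ, 2 * k ≤ n ∧ m ≤ min (2 * k) (n - 2 * k) ∧ c = burnsideEigenvalue k := by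
  rw [Module.End.hasEigenvalue_iff_isRoot_charpoly, hT, IsRoot, eval_prod, Finset.prod_eq_zero_iff]
  simp only [Finset.mem_univ, true_and, eval_sub, eval_X, eval_C, sub_eq_zero,
    differenceMoment_eq_iff hc]
  constructor
  · rintro ⟨i, k, hk, h⟩
    have := i.2
    exact ⟨k, by omega, by omega, h⟩
  · rintro ⟨k, h1, h2, h⟩
    have h3 := h2.trans (min_le_left _ _)
    have h4 := h2.trans (min_le_right _ _)
    -- The factor with `m + i = 2k`; the bound `m ≤ n - 2k` keeps `i` in range.
    exact ⟨⟨2 * k - m, by omega⟩, k, by simp only; omega, h⟩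

open Polynomial in
theorem hasMultiplicity_one_of_charpoly {n m : ℕ} (hm : 2 * m ≤ n) {V : Type*} [AddCommGroup V]
    [Module ℂ V] [Module.Finite ℂ V] {T : Module.End ℂ V}
    (hT : T.charpoly = ∏ i : Fin (n - 2 * m + 1), (X - C (differenceMoment (m + i))))
    {k : ℕ} (hk : 2 * k ≤ n) (hmk : m ≤ min (2 * k) (n - 2 * k)) :
    HasMultiplicity T (burnsideEigenvalue k) 1 := by
  have h1 : Module.finrank ℂ (T.maxGenEigenspace (burnsideEigenvalue k)) = 1 := by
    have h3 := hmk.trans (min_le_left _ _)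
    have h4 := hmk.trans (min_le_right _ _)
    have hprod : T.charpoly = (Multiset.map (fun a => X - C a)
        (Finset.univ.val.map fun i : Fin (n - 2 * m + 1) => differenceMoment (m + i))).prod := by
      rw [hT, Multiset.map_map]
      rfl
    rw [LinearMap.finrank_maxGenEigenspace_eq, ← count_roots, hprod, roots_multiset_prod_X_sub_C,
      Multiset.count_map, ← Finset.filter_val, Finset.card_val, Finset.card_eq_one]
    -- Odd moments vanish and the β's are distinct, so only the factor with `m + i = 2k` has the
    -- root β_k.
    refine ⟨⟨2 * k - m, by omega⟩, ?_⟩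
    ext i
    simp only [Finset.mem_filter, Finset.mem_univ, true_and, Finset.mem_singleton,
      differenceMoment_eq_iff (burnsideEigenvalue_ne_zero k), Fin.ext_iff]
    constructor
    · rintro ⟨k', hk', h⟩
      rw [burnsideEigenvalue_injective h]
      omega
    · intro h
      exact ⟨k, by omega, rfl⟩
  refine ⟨le_antisymm ?_ ?_, h1⟩
  · rw [← h1]
    exact Submodule.finrank_mono (T.genEigenspace_le_maximal _ 1)
  · rw [Nat.one_le_iff_ne_zero, Ne, Submodule.finrank_eq_zero]
    exact (hasEigenvalue_iff_of_charpoly hm hT (burnsideEigenvalue_ne_zero k)).2 ⟨k, hk, hmk, rfl⟩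

/-- By flatness over a field, the kernel of `1 ⊗ A` is `S ⊗ ker A`. -/
theorem finrank_ker_conj_lTensor {S L V : Type*} [AddCommGroup S] [Module ℂ S]
    [AddCommGroup L] [Module ℂ L] [AddCommGroup V] [Module ℂ V] (Φ : S ⊗[ℂ] L ≃ₗ[ℂ] V)
    (A : Module.End ℂ L) :
    Module.finrank ℂ (LinearMap.ker (Φ.conj (LinearMap.lTensor S A))) =
      Module.finrank ℂ S * Module.finrank ℂ (LinearMap.ker A) := by
  have h1 : LinearMap.ker (Φ.conj (LinearMap.lTensor S A)) =
      (LinearMap.ker (LinearMap.lTensor S A)).map Φ.toLinearMap := by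
    ext v
    rw [LinearMap.mem_ker, LinearEquiv.conj_apply_apply, LinearEquiv.map_eq_zero_iff]
    constructor
    · intro h
      exact ⟨Φ.symm v, h, Φ.apply_symm_apply v⟩
    · rintro ⟨t, ht, rfl⟩
      simpa using ht
  have h2 : LinearMap.ker (LinearMap.lTensor S A) =
      LinearMap.range (LinearMap.lTensor S (LinearMap.ker A).subtype) :=
    LinearMap.exact_iff.1 (Module.Flat.lTensor_exact S (LinearMap.exact_subtype_ker_map A))
  have h3 : Function.Injective (LinearMap.lTensor S (LinearMap.ker A).subtype) :=
    Module.Flat.lTensor_preserves_injective_linearMap _ (Submodule.injective_subtype _)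
  rw [h1, LinearEquiv.finrank_map_eq, h2, LinearMap.finrank_range_of_inj h3,
    Module.finrank_tensorProduct]

theorem conj_lTensor_sub_pow {S L V : Type*} [AddCommGroup S] [Module ℂ S]
    [AddCommGroup L] [Module ℂ L] [AddCommGroup V] [Module ℂ V] (Φ : S ⊗[ℂ] L ≃ₗ[ℂ] V)
    (A : Module.End ℂ L) (c : ℂ) (k : ℕ) :
    (Φ.conj (LinearMap.lTensor S A) - c • 1) ^ k =
      Φ.conj (LinearMap.lTensor S ((A - c • 1) ^ k)) := by
  have h : Φ.conj (LinearMap.lTensor S A) - c • 1 = Φ.conj (LinearMap.lTensor S (A - c • 1)) := by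
    rw [LinearMap.lTensor_sub, LinearMap.lTensor_smul, map_sub, map_smul, Module.End.one_eq_id,
      Module.End.one_eq_id, LinearMap.lTensor_id, LinearEquiv.conj_id]
  rw [h]
  induction k with
  | zero =>
    rw [pow_zero, pow_zero, Module.End.one_eq_id, Module.End.one_eq_id, LinearMap.lTensor_id,
      LinearEquiv.conj_id]
  | succ k ih =>
    rw [pow_succ, pow_succ, ih, Module.End.mul_eq_comp, Module.End.mul_eq_comp,
      LinearMap.lTensor_comp, LinearEquiv.conj_comp]

theorem finrank_eigenspace_conj_lTensor {S L V : Type*} [AddCommGroup S] [Module ℂ S]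
    [AddCommGroup L] [Module ℂ L] [AddCommGroup V] [Module ℂ V] (Φ : S ⊗[ℂ] L ≃ₗ[ℂ] V)
    (A : Module.End ℂ L) (c : ℂ) :
    Module.finrank ℂ ((Φ.conj (LinearMap.lTensor S A)).eigenspace c) =
      Module.finrank ℂ S * Module.finrank ℂ (A.eigenspace c) := by
  have h := conj_lTensor_sub_pow Φ A c 1
  rw [pow_one, pow_one] at h
  rw [Module.End.eigenspace_def, h, finrank_ker_conj_lTensor, Module.End.eigenspace_def]

/-- Both generalized eigenspaces are kernels of the same power, the exponent being the larger of the
two dimensions. -/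
theorem finrank_maxGenEigenspace_conj_lTensor {S L V : Type*} [AddCommGroup S] [Module ℂ S]
    [AddCommGroup L] [Module ℂ L] [AddCommGroup V] [Module ℂ V] [Module.Finite ℂ L]
    [Module.Finite ℂ V] (Φ : S ⊗[ℂ] L ≃ₗ[ℂ] V) (A : Module.End ℂ L) (c : ℂ) :
    Module.finrank ℂ ((Φ.conj (LinearMap.lTensor S A)).maxGenEigenspace c) =
      Module.finrank ℂ S * Module.finrank ℂ (A.maxGenEigenspace c) := by
  have h1 := le_max_left (Module.finrank ℂ L) (Module.finrank ℂ V)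
  have h2 := le_max_right (Module.finrank ℂ L) (Module.finrank ℂ V)
  rw [Module.End.maxGenEigenspace_eq_genEigenspace_finrank,
    Module.End.maxGenEigenspace_eq_genEigenspace_finrank,
    ← Module.End.genEigenspace_eq_genEigenspace_finrank_of_le _ _ h1,
    ← Module.End.genEigenspace_eq_genEigenspace_finrank_of_le _ _ h2,
    Module.End.genEigenspace_nat, Module.End.genEigenspace_nat, conj_lTensor_sub_pow,
    finrank_ker_conj_lTensor]

end Multiplicity

/-! ### Comparing arbitrary equivariant identifications with evaluation. -/

section Comparison

variable {n m : ℕ} {hm : 2 * m ≤ n}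

theorem restrict_binaryBurnside_eq_conj
    (hK : ∀ f ∈ spechtIsotypic n (twoRow n m hm),
      binaryBurnside n f ∈ spechtIsotypic n (twoRow n m hm)) :
    (binaryBurnside n).restrict hK = (evalEquiv n m hm).conj
      (LinearMap.lTensor (Specht n (twoRow n m hm)) (multiplicityBurnside n m hm)) := by
  refine LinearMap.ext fun f => ?_
  obtain ⟨t, rfl⟩ := (evalEquiv n m hm).surjective f
  rw [LinearEquiv.conj_apply_apply, LinearEquiv.symm_apply_apply]
  induction t using TensorProduct.induction_on with
  | zero => simp only [map_zero]
  | add t u ht hu => simp only [map_add, ht, hu]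
  | tmul v φ => rfl

variable {L : Type*} [AddCommGroup L] [Module ℂ L]

/-- An equivariant identification of the isotypic component with `S ⊗ L` identifies `L` with the
multiplicity space. -/
noncomputable def toMultiplicitySpace
    (Φ : Specht n (twoRow n m hm) ⊗[ℂ] L ≃ₗ[ℂ] spechtIsotypic n (twoRow n m hm))
    (hΦ : IsPermEquivariant Φ) :
    L →ₗ[ℂ] (spechtRep n (twoRow n m hm)).IntertwiningMap (binaryRep n) where
  toFun l :=
    { toFun := fun v => Φ (v ⊗ₜ l)
      map_add' := fun v w => by rw [TensorProduct.add_tmul, map_add]; rfl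
      map_smul' := fun c v => by rw [← TensorProduct.smul_tmul', map_smul]; rfl
      isIntertwining' := fun g => LinearMap.ext fun v => hΦ g v l }
  map_add' l l' := Representation.IntertwiningMap.ext_apply fun v => by
    change ((Φ (v ⊗ₜ (l + l')) : _) : BinaryFun n) = Φ (v ⊗ₜ l) + Φ (v ⊗ₜ l')
    rw [TensorProduct.tmul_add, map_add]
    rfl
  map_smul' c l := Representation.IntertwiningMap.ext_apply fun v => by
    change ((Φ (v ⊗ₜ (c • l)) : _) : BinaryFun n) = c • (Φ (v ⊗ₜ l) : BinaryFun n)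
    rw [TensorProduct.tmul_smul, map_smul]
    rfl

/-- After tensoring with the Specht module the map becomes `Φ` followed by the inverse of
evaluation. The Specht module is nonzero, hence faithfully flat, so bijectivity descends. -/
theorem toMultiplicitySpace_bijective
    (Φ : Specht n (twoRow n m hm) ⊗[ℂ] L ≃ₗ[ℂ] spechtIsotypic n (twoRow n m hm))
    (hΦ : IsPermEquivariant Φ) : Function.Bijective (toMultiplicitySpace Φ hΦ) := by
  rw [← Module.FaithfullyFlat.lTensor_bijective_iff_bijective ℂ (Specht n (twoRow n m hm))]
  have h : LinearMap.lTensor (Specht n (twoRow n m hm)) (toMultiplicitySpace Φ hΦ) =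
      (Φ.trans (evalEquiv n m hm).symm).toLinearMap := by
    refine TensorProduct.ext' fun v l => ?_
    rw [LinearMap.lTensor_tmul, LinearEquiv.coe_coe, LinearEquiv.trans_apply,
      LinearEquiv.eq_symm_apply]
    rfl
  rw [h]
  exact (Φ.trans (evalEquiv n m hm).symm).bijective

end Comparison

/-! ### The final assembly. -/

theorem corollary3p3 (n m : ℕ) (hm : 2 * m ≤ n) :
    (∃ (L : Type) (_ : AddCommGroup L) (_ : Module ℂ L) (_ : LieRingModule sl2 L)
        (_ : LieModule ℂ sl2 L),
      LieModule.IsIrreducible ℂ sl2 L ∧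
      ∃ Φ : Specht n (twoRow n m hm) ⊗[ℂ] L ≃ₗ[ℂ] spechtIsotypic n (twoRow n m hm),
        IsPermEquivariant Φ ∧ IsSl2Equivariant Φ) ∧
    ∃ hK : ∀ f ∈ spechtIsotypic n (twoRow n m hm),
        binaryBurnside n f ∈ spechtIsotypic n (twoRow n m hm),
      (∀ k : ℕ, 2 * k ≤ n → m ≤ min (2 * k) (n - 2 * k) →
        HasMultiplicity ((binaryBurnside n).restrict hK) (burnsideEigenvalue k)
          (Module.finrank ℂ (Specht n (twoRow n m hm)))) ∧
      (∀ c : ℂ, c ≠ 0 → (Module.End.HasEigenvalue ((binaryBurnside n).restrict hK) c ↔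
        ∃ k : ℕ, 2 * k ≤ n ∧ m ≤ min (2 * k) (n - 2 * k) ∧ c = burnsideEigenvalue k)) ∧
      ∀ (L : Type*) [AddCommGroup L] [Module ℂ L]
        (Φ : Specht n (twoRow n m hm) ⊗[ℂ] L ≃ₗ[ℂ] spechtIsotypic n (twoRow n m hm)),
        IsPermEquivariant Φ →
        ∃ K' : Module.End ℂ L,
          (∀ K'' : Module.End ℂ L,
            (∀ t, (binaryBurnside n).restrict hK (Φ t) =
              Φ (LinearMap.lTensor (Specht n (twoRow n m hm)) K'' t)) ↔ K'' = K') ∧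
          (∀ k : ℕ, 2 * k ≤ n → m ≤ min (2 * k) (n - 2 * k) →
            HasMultiplicity K' (burnsideEigenvalue k) 1) ∧
          (∀ c : ℂ, c ≠ 0 → (K'.HasEigenvalue c ↔
            ∃ k : ℕ, 2 * k ≤ n ∧ m ≤ min (2 * k) (n - 2 * k) ∧ c = burnsideEigenvalue k)) := by
  have hK := binaryBurnside_mem_spechtIsotypic (n := n) (hm := hm)
  have hchar := charpoly_multiplicityBurnside (hm := hm)
  refine ⟨⟨_, _, _, multiplicityLieRingModule, multiplicityLieModule,
    isIrreducible_multiplicitySpace, evalEquiv n m hm, isPermEquivariant_evalEquiv,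
    isSl2Equivariant_evalEquiv⟩, hK, ?_, ?_, ?_⟩
  · intro k hk hmk
    have h := hasMultiplicity_one_of_charpoly hm hchar hk hmk
    rw [restrict_binaryBurnside_eq_conj]
    constructor
    · rw [finrank_eigenspace_conj_lTensor, h.1, mul_one]
    · rw [finrank_maxGenEigenspace_conj_lTensor, h.2, mul_one]
  · intro c hc
    -- Eigenvalues are detected by the dimensions of eigenspaces, which differ by the nonzero factor
    -- `dim S^λ`.
    rw [← hasEigenvalue_iff_of_charpoly hm hchar hc, restrict_binaryBurnside_eq_conj,
      Module.End.hasEigenvalue_iff, Module.End.hasEigenvalue_iff, Ne, Ne,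
      ← Submodule.finrank_eq_zero (R := ℂ), ← Submodule.finrank_eq_zero (R := ℂ),
      finrank_eigenspace_conj_lTensor, mul_eq_zero]
    have h0 : Module.finrank ℂ (Specht n (twoRow n m hm)) ≠ 0 := Module.finrank_pos.ne'
    tauto
  · intro L _ _ Φ hΦ
    -- Transporting the operator along `a` gives the required one on `L`. It is unique because `l`
    -- is recovered from the map `v ↦ Φ (v ⊗ l)`.
    let a := LinearEquiv.ofBijective _ (toMultiplicitySpace_bijective Φ hΦ)
    have ha : ∀ (l : L) (v : Specht n (twoRow n m hm)),
        a l v = (Φ (v ⊗ₜ l) : BinaryFun n) := fun _ _ => rfl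
    have : Module.Finite ℂ L := Module.Finite.equiv a.symm
    have hchar' : (a.symm.conj (multiplicityBurnside n m hm)).charpoly = _ :=
      (LinearEquiv.charpoly_conj _ _).trans hchar
    refine ⟨a.symm.conj (multiplicityBurnside n m hm), fun K'' => ?_,
      fun k => hasMultiplicity_one_of_charpoly hm hchar',
      fun c => hasEigenvalue_iff_of_charpoly hm hchar'⟩
    have key : ∀ l, a (a.symm.conj (multiplicityBurnside n m hm) l) =
        multiplicityBurnside n m hm (a l) := fun l => by
      rw [LinearEquiv.conj_apply_apply, LinearEquiv.apply_symm_apply, LinearEquiv.symm_symm]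
    constructor
    · intro h
      refine LinearMap.ext fun l => a.injective ?_
      rw [key]
      refine Representation.IntertwiningMap.ext_apply fun v => ?_
      exact (congrArg Subtype.val (h (v ⊗ₜ l))).symm
    · rintro rfl t
      induction t using TensorProduct.induction_on with
      | zero => simp only [map_zero]
      | add t u ht hu => simp only [map_add, ht, hu]
      | tmul v l =>
        apply Subtype.ext
        rw [LinearMap.lTensor_tmul, ← ha, key]
        rfl
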